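/- For an integer $k\ge 3$ let $P_k=\operatorname{conv}(1,\zeta_k,\dots,\zeta_k^{k-1})\subset\mathbb{C}=\mathbb{R}^2$, with $\zeta_k=e^{2\pi i/k}$, be the regular $k$-gon. For $m,n\ge 3$ let $\operatorname{Hom}(P_m,P_n)$ be the set of all affine maps $P_m\to P_n$. It is a convex polytope in the $6$-dimensional real vector space of affine maps $\mathbb{R}^2\to\mathbb{R}^2$ (each affine map $P_m\to P_n$ being identified with its unique affine extension to $\mathbb{R}^2$). The rank of $f\in\operatorname{Hom}(P_m,P_n)$ is the dimension of its image $f(P_m)$. Proposition (full-rank vertices of $\operatorname{Hom}(P_4,P_n)$). For every integer $n\ge 3$, the number of vertices of the polytope $\operatorname{Hom}(P_4,P_n)$ that have full rank, i.e. rank two, is $$\begin{cases} n^3-9n & \text{for } n \text{ odd},\\ n^3-5n^2+6n & \text{for } n \text{ even}.\end{cases}$$ -/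

import Mathlib

noncomputable section

/-- The standard regular `n`-gon: the convex hull in `ℂ = ℝ ⊕ ℝ` of
`1, ζ, ζ ^ 2, …, ζ ^ (n - 1)`, where `ζ = cos (2 * π / n) + sin (2 * π / n) * i`. -/
def regularPolygon (n : ℕ) : Set ℂ :=
  convexHull ℝ (Set.range fun k : Fin n =>
    ((Real.cos (2 * Real.pi / n) : ℂ) + (Real.sin (2 * Real.pi / n) : ℂ) * Complex.I) ^ (k : ℕ))

/-- The hom-polytope `Hom(P, Q)` of two polygons in the plane, as a subset of the real vector
space of affine maps of the plane.  For `P` with affine hull the whole plane (the only case in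
which it is used), an affine map `P → Q` is the restriction of exactly one affine map of the
plane sending `P` into `Q`, so this is the set of all affine maps `P → Q`. -/
def homPolytope (P Q : Set ℂ) : Set (ℂ →ᵃ[ℝ] ℂ) :=
  {f | Set.MapsTo f P Q}

/-- The rank of an affine map on `P`: the dimension of (the affine hull of) the image of `P`. -/
def mapRank (P : Set ℂ) (f : ℂ →ᵃ[ℝ] ℂ) : ℕ :=
  Module.finrank ℝ (vectorSpan ℝ (f '' P))

/-- The vertices (extreme points) of `Hom(P, Q)` of rank `r`. -/
def verticesOfRank (P Q : Set ℂ) (r : ℕ) : Set (ℂ →ᵃ[ℝ] ℂ) :=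
  {f | f ∈ (homPolytope P Q).extremePoints ℝ ∧ mapRank P f = r}

end

/-!
A point of a convex set is extreme if and only if it cannot be moved both ways in any direction. An
affine map from the square is given by the images of the corners, the corners of a parallelogram in
the `n`-gon, and it is a vertex of the hom-polytope if and only if the corners have no nonzero free
directions that keep the parallelogram a parallelogram. Such a rigid parallelogram has at most two
corners which are not vertices of the `n`-gon, and if there are two, they lie on nonparallel open
edges. They are not opposite corners: the other two corners span a chord, and as the smaller of the
two caps cut off by it stays in the polygon under the half turn about the midpoint, both corners
would lie on that chord.

Three corners at vertices of the `n`-gon make a parallelogram rigid, and its fourth corner lies in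
the `n`-gon if and only if the angle at the second corner is at least a right angle. If just two
adjacent corners are vertices, the other two sides are parallel to the axis of symmetry of these two
vertices and extend as far as possible. For even `n` they would reach vertices, and for odd `n` they
end in the open edges opposite to the two vertices. With `M = ⌊(n - 1) / 2⌋` the count is
`n (n - 2) + 4 n M (M - 1)` for even `n` and `4 n M (M - 1) + 4 n (n - 3)` for odd `n`.
-/

noncomputable section

open Complex

/-- The point of the unit circle with argument `s * π / n`. Even `s` are the vertices of the
regular `n`-gon, odd `s` the outer unit normals of its edges. -/
def cis (n : ℕ) (s : ℤ) : ℂ :=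
  ⟨Real.cos (s * (Real.pi / n)), Real.sin (s * (Real.pi / n))⟩

section cis

variable {n : ℕ}

lemma cis_add (s t : ℤ) : cis n (s + t) = cis n s * cis n t := by
  apply Complex.ext
  · simp [cis, add_mul, Real.cos_add]
  · simp only [cis, Int.cast_add, add_mul, Real.sin_add, mul_im]
    ring

@[simp] lemma cis_zero : cis n 0 = 1 := by
  apply Complex.ext <;> simp [cis]

@[simp] lemma cis_neg_re (s : ℤ) : (cis n (-s)).re = (cis n s).re := by simp [cis]

@[simp] lemma cis_neg_im (s : ℤ) : (cis n (-s)).im = -(cis n s).im := by simp [cis]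

lemma cis_add_re (s t : ℤ) :
    (cis n (s + t)).re = (cis n s).re * (cis n t).re - (cis n s).im * (cis n t).im := by
  rw [cis_add, mul_re]

lemma cis_add_im (s t : ℤ) :
    (cis n (s + t)).im = (cis n s).re * (cis n t).im + (cis n s).im * (cis n t).re := by
  rw [cis_add, mul_im]

lemma cis_sq_add_sq (s : ℤ) : (cis n s).re ^ 2 + (cis n s).im ^ 2 = 1 :=
  Real.cos_sq_add_sin_sq _

lemma cis_two_mul_re (s : ℤ) : (cis n (2 * s)).re = 1 - 2 * (cis n s).im ^ 2 := by
  rw [two_mul, cis_add_re]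
  linarith [cis_sq_add_sq (n := n) s]

@[simp] lemma norm_cis (s : ℤ) : ‖cis n s‖ = 1 := by
  rw [← sq_eq_sq₀ (norm_nonneg _) zero_le_one, ← normSq_eq_norm_sq, normSq_apply]
  linarith [cis_sq_add_sq (n := n) s]

lemma cis_pow (s : ℤ) (k : ℕ) : cis n s ^ k = cis n (k * s) := by
  induction k with
  | zero => simp
  | succ k ih => rw [pow_succ, ih, ← cis_add]; congr 1; push_cast; ring

lemma cis_add_add_cis_sub (s t : ℤ) :
    cis n (s + t) + cis n (s - t) = (2 * (cis n t).re) • cis n s := by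
  apply Complex.ext <;>
    simp only [sub_eq_add_neg, add_re, add_im, cis_add_re, cis_add_im, cis_neg_re, cis_neg_im,
      smul_re, smul_im, smul_eq_mul] <;> ring

lemma cis_add_sub_cis_sub (s t : ℤ) :
    cis n (s + t) - cis n (s - t) = (2 * (cis n t).im) • (I * cis n s) := by
  apply Complex.ext <;>
    simp only [sub_eq_add_neg s, sub_re, sub_im, cis_add_re, cis_add_im, cis_neg_re, cis_neg_im,
      smul_re, smul_im, smul_eq_mul, I_mul_re, I_mul_im] <;> ring

lemma natCast_mul_pi_div (hn : n ≠ 0) : ((n : ℤ) : ℝ) * (Real.pi / n) = Real.pi := by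
  push_cast
  field_simp

lemma cis_self (hn : n ≠ 0) : cis n n = -1 := by
  apply Complex.ext <;> simp only [cis, natCast_mul_pi_div hn] <;> simp

lemma cis_add_self (hn : n ≠ 0) (s : ℤ) : cis n (s + n) = -cis n s := by
  rw [cis_add, cis_self hn, mul_neg_one]

lemma cis_add_two_mul (hn : n ≠ 0) (s k : ℤ) : cis n (s + 2 * n * k) = cis n s := by
  have h : ((s + 2 * n * k : ℤ) : ℝ) * (Real.pi / n) = s * (Real.pi / n) + k * (2 * Real.pi) := by
    push_cast
    field_simp
  simp only [cis, h, Real.cos_add_int_mul_two_pi, Real.sin_add_int_mul_two_pi]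

lemma cis_self_sub_re (hn : n ≠ 0) (s : ℤ) : (cis n (n - s)).re = -(cis n s).re := by
  rw [show (n : ℤ) - s = -s + n by ring, cis_add_self hn, neg_re, cis_neg_re]

lemma strictAntiOn_cis_re (hn : n ≠ 0) : StrictAntiOn (fun s => (cis n s).re) (Set.Icc 0 n) := by
  have angle_mem : ∀ s ∈ Set.Icc (0 : ℤ) n, s * (Real.pi / n) ∈ Set.Icc 0 Real.pi := by
    rintro s ⟨h0, h1⟩
    refine ⟨by positivity, ?_⟩
    calc s * (Real.pi / n) ≤ (n : ℤ) * (Real.pi / n) := by gcongr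
      _ = Real.pi := natCast_mul_pi_div hn
  intro r hr s hs hrs
  exact Real.strictAntiOn_cos (angle_mem r hr) (angle_mem s hs) (by gcongr)

lemma cis_abs_re (s : ℤ) : (cis n |s|).re = (cis n s).re := by
  rcases abs_choice s with h | h <;> simp [h]

lemma cis_re_le_of_abs_le (hn : n ≠ 0) {k m : ℤ} (h : |k| ≤ m) (hm : m ≤ n) :
    (cis n m).re ≤ (cis n k).re := by
  rw [← cis_abs_re k]
  exact (strictAntiOn_cis_re hn).antitoneOn ⟨abs_nonneg k, h.trans hm⟩
    ⟨(abs_nonneg k).trans h, hm⟩ h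

lemma exists_cis_re_eq (hn : n ≠ 0) (m : ℤ) : ∃ r ∈ Set.Icc (0 : ℤ) n,
    (cis n m).re = (cis n r).re ∧ ((2 * n : ℤ) ∣ m - r ∨ (2 * n : ℤ) ∣ m + r) := by
  have hn' : (0 : ℤ) < 2 * n := by positivity
  have h0 := Int.emod_nonneg m hn'.ne'
  have h1 := Int.emod_lt_of_pos m hn'
  have h2 := Int.emod_add_mul_ediv m (2 * n)
  set r := m % (2 * n)
  have hc : cis n m = cis n r := by rw [← h2, cis_add_two_mul hn]
  rcases le_or_gt r n with h | h
  · exact ⟨r, ⟨h0, h⟩, by rw [hc], Or.inl ⟨m / (2 * n), by linarith⟩⟩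
  · refine ⟨2 * n - r, ⟨by linarith, by linarith⟩, ?_, Or.inr ⟨m / (2 * n) + 1, by linarith⟩⟩
    rw [hc, show (2 * n - r : ℤ) = -r + 2 * n * 1 by ring, cis_add_two_mul hn, cis_neg_re]

lemma cis_re_eq_one_iff (hn : n ≠ 0) (m : ℤ) : (cis n m).re = 1 ↔ (2 * n : ℤ) ∣ m := by
  obtain ⟨r, hr, hc, hd⟩ := exists_cis_re_eq hn m
  constructor
  · intro h
    have hr0 : r = 0 := (strictAntiOn_cis_re hn).injOn hr ⟨le_rfl, by positivity⟩
      (by simp [← hc, h])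
    simpa [hr0] using hd
  · rintro ⟨k, rfl⟩
    simpa using congrArg re (cis_add_two_mul hn 0 k)

lemma cis_eq_iff (hn : n ≠ 0) (s t : ℤ) : cis n s = cis n t ↔ (2 * n : ℤ) ∣ s - t := by
  constructor
  · intro h
    rw [← cis_re_eq_one_iff hn, sub_eq_add_neg, cis_add_re, cis_neg_re, cis_neg_im, h]
    linarith [cis_sq_add_sq (n := n) t]
  · rintro ⟨k, hk⟩
    rw [show s = t + 2 * n * k by linarith, cis_add_two_mul hn]

lemma cis_im_eq_zero_iff (hn : n ≠ 0) (m : ℤ) : (cis n m).im = 0 ↔ (n : ℤ) ∣ m := by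
  rw [← mul_dvd_mul_iff_left (two_ne_zero' ℤ), ← cis_re_eq_one_iff hn, cis_two_mul_re]
  simp

lemma cis_odd_re_le (hn : n ≠ 0) (m : ℤ) : (cis n (2 * m + 1)).re ≤ (cis n 1).re := by
  obtain ⟨r, ⟨h0, h1⟩, hc, hd⟩ := exists_cis_re_eq hn (2 * m + 1)
  have hr : 1 ≤ r := by
    rcases hd with ⟨k, hk⟩ | ⟨k, hk⟩ <;> rw [mul_assoc] at hk <;> omega
  rw [hc]
  exact cis_re_le_of_abs_le hn (by simpa using hr) h1

lemma cis_odd_re_eq_iff (hn : n ≠ 0) (m : ℤ) :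
    (cis n (2 * m + 1)).re = (cis n 1).re ↔ (n : ℤ) ∣ m ∨ (n : ℤ) ∣ m + 1 := by
  constructor
  · intro h
    obtain ⟨r, hr, hc, hd⟩ := exists_cis_re_eq hn (2 * m + 1)
    have hr1 : r = 1 := (strictAntiOn_cis_re hn).injOn hr
      ⟨zero_le_one, by exact_mod_cast Nat.one_le_iff_ne_zero.mpr hn⟩ (hc.symm.trans h)
    subst hr1
    rcases hd with ⟨k, hk⟩ | ⟨k, hk⟩ <;> rw [mul_assoc] at hk
    · exact Or.inl ⟨k, by linarith⟩
    · exact Or.inr ⟨k, by linarith⟩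
  · rintro (⟨k, hk⟩ | ⟨k, hk⟩)
    · rw [show 2 * m + 1 = 1 + 2 * n * k by linarith, cis_add_two_mul hn]
    · rw [show 2 * m + 1 = -1 + 2 * n * k by linarith, cis_add_two_mul hn, cis_neg_re]

lemma cis_im_pos {m : ℤ} (h0 : 0 < m) (h1 : m < n) : 0 < (cis n m).im := by
  have hn : n ≠ 0 := by omega
  apply Real.sin_pos_of_pos_of_lt_pi (by positivity)
  calc m * (Real.pi / n) < (n : ℤ) * (Real.pi / n) := by gcongr
    _ = Real.pi := natCast_mul_pi_div hn

lemma cis_re_pos {m : ℤ} (h0 : 0 ≤ m) (h1 : 2 * m < n) : 0 < (cis n m).re := by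
  have hn : n ≠ 0 := by omega
  have h := strictAntiOn_cis_re hn ⟨h0, by omega⟩ (b := n - m) ⟨by omega, by omega⟩ (by omega)
  dsimp only at h
  rw [cis_self_sub_re hn] at h
  linarith

lemma cis_re_neg {m : ℤ} (h0 : n < 2 * m) (h1 : m ≤ n) : (cis n m).re < 0 := by
  have h := cis_re_pos (n := n) (m := n - m) (by omega) (by omega)
  rw [cis_self_sub_re (by omega)] at h
  linarith

lemma cis_im_le {m k : ℤ} (h0 : 0 < m) (h1 : m ≤ k) (h2 : k ≤ n - m) :
    (cis n m).im ≤ (cis n k).im := by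
  have hn : n ≠ 0 := by omega
  have hk : (cis n k).re ≤ (cis n m).re :=
    cis_re_le_of_abs_le hn (by rwa [abs_of_pos h0]) (by omega)
  have hk' : (cis n (n - k)).re ≤ (cis n m).re :=
    cis_re_le_of_abs_le hn (by rw [abs_of_pos h0]; omega) (by omega)
  rw [cis_self_sub_re hn] at hk'
  have hsq : (cis n k).re ^ 2 ≤ (cis n m).re ^ 2 := sq_le_sq' (by linarith) hk
  apply le_of_sq_le_sq _ (cis_im_pos (by omega) (by omega)).le
  linarith [cis_sq_add_sq (n := n) m, cis_sq_add_sq (n := n) k]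

end cis

/-- The coordinate of a point along the unit vector `cis n s`. -/
def proj (n : ℕ) (s : ℤ) : ℂ →ₗ[ℝ] ℝ := (cis n s).re • reLm + (cis n s).im • imLm

/-- The coordinate of a point along `I * cis n s`, the unit vector `cis n s` turned left. -/
def perp (n : ℕ) (s : ℤ) : ℂ →ₗ[ℝ] ℝ := (cis n s).re • imLm - (cis n s).im • reLm

/-- The signed area of the parallelogram spanned by two vectors of the plane. -/
def planeDet (z w : ℂ) : ℝ := z.re * w.im - z.im * w.re

section frame

variable {n : ℕ}

lemma proj_apply (s : ℤ) (z : ℂ) : proj n s z = (cis n s).re * z.re + (cis n s).im * z.im := rfl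

lemma perp_apply (s : ℤ) (z : ℂ) : perp n s z = (cis n s).re * z.im - (cis n s).im * z.re := rfl

@[simp] lemma proj_cis (s t : ℤ) : proj n s (cis n t) = (cis n (t - s)).re := by
  simp only [proj_apply, sub_eq_add_neg, cis_add_re, cis_neg_re, cis_neg_im]
  ring

@[simp] lemma perp_cis (s t : ℤ) : perp n s (cis n t) = (cis n (t - s)).im := by
  simp only [perp_apply, sub_eq_add_neg t, cis_add_im, cis_neg_re, cis_neg_im]
  ring

lemma proj_sq_add_perp_sq (s : ℤ) (z : ℂ) : proj n s z ^ 2 + perp n s z ^ 2 = ‖z‖ ^ 2 := by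
  rw [← normSq_eq_norm_sq, normSq_apply, proj_apply, perp_apply]
  linear_combination (z.re * z.re + z.im * z.im) * cis_sq_add_sq (n := n) s

lemma abs_proj_le (s : ℤ) (z : ℂ) : |proj n s z| ≤ ‖z‖ :=
  abs_le_of_sq_le_sq (by linarith [proj_sq_add_perp_sq (n := n) s z, sq_nonneg (perp n s z)])
    (norm_nonneg z)

lemma proj_add_self (hn : n ≠ 0) (s : ℤ) (z : ℂ) : proj n (s + n) z = -proj n s z := by
  simp only [proj_apply, cis_add_self hn, neg_re, neg_im]
  ring

lemma proj_eq_proj_perp (s t : ℤ) (z : ℂ) :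
    proj n t z = proj n s z * (cis n (t - s)).re + perp n s z * (cis n (t - s)).im := by
  simp only [proj_apply, perp_apply, sub_eq_add_neg t, cis_add_re, cis_add_im, cis_neg_re,
    cis_neg_im]
  linear_combination
    (-((cis n t).re * z.re + (cis n t).im * z.im)) * cis_sq_add_sq (n := n) s

lemma perp_eq_proj_perp (s t : ℤ) (z : ℂ) :
    perp n t z = perp n s z * (cis n (t - s)).re - proj n s z * (cis n (t - s)).im := by
  simp only [proj_apply, perp_apply, sub_eq_add_neg t, cis_add_re, cis_add_im, cis_neg_re,
    cis_neg_im]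
  linear_combination
    (-((cis n t).re * z.im - (cis n t).im * z.re)) * cis_sq_add_sq (n := n) s

lemma ext_proj_perp (s : ℤ) {z w : ℂ} (h₁ : proj n s z = proj n s w)
    (h₂ : perp n s z = perp n s w) : z = w := by
  rw [← sub_eq_zero, ← map_sub] at h₁ h₂
  have h := proj_sq_add_perp_sq (n := n) s (z - w)
  rw [h₁, h₂] at h
  simpa [eq_comm, sub_eq_zero] using h

lemma planeDet_eq_proj_perp (s : ℤ) (z w : ℂ) :
    planeDet z w = proj n s z * perp n s w - perp n s z * proj n s w := by
  simp only [planeDet, proj_apply, perp_apply]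
  linear_combination (-(z.re * w.im - z.im * w.re)) * cis_sq_add_sq (n := n) s

end frame

/-- The vertices of the regular `n`-gon. -/
def polygonVertices (n : ℕ) : Set ℂ := Set.range fun k : ℤ => cis n (2 * k)

/-- The relatively open edge of the regular `n`-gon with outer unit normal `cis n (2 * t + 1)`. -/
def openEdge (n : ℕ) (t : ℤ) : Set ℂ := openSegment ℝ (cis n (2 * t)) (cis n (2 * t + 2))

section polygon

open scoped Pointwise

variable {n : ℕ}

lemma cis_two_mul_mem_polygonVertices (k : ℤ) : cis n (2 * k) ∈ polygonVertices n := ⟨k, rfl⟩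

lemma cis_two_mul_add_two_mem_polygonVertices (k : ℤ) : cis n (2 * k + 2) ∈ polygonVertices n :=
  ⟨k + 1, congrArg _ (mul_add _ _ _)⟩

lemma norm_eq_one_of_mem_polygonVertices {z : ℂ} (hz : z ∈ polygonVertices n) : ‖z‖ = 1 := by
  obtain ⟨k, rfl⟩ := hz
  exact norm_cis _

lemma regularPolygon_eq_convexHull (hn : n ≠ 0) :
    regularPolygon n = convexHull ℝ (polygonVertices n) := by
  have hζ : (Real.cos (2 * Real.pi / n) : ℂ) + (Real.sin (2 * Real.pi / n) : ℂ) * I = cis n 2 := by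
    apply Complex.ext <;> simp [cis, -ofReal_cos, -ofReal_sin, mul_div_assoc]
  rw [regularPolygon, polygonVertices, hζ]
  congr 1
  apply subset_antisymm
  · rintro _ ⟨k, rfl⟩
    exact ⟨k, by simp [cis_pow, mul_comm]⟩
  · rintro _ ⟨k, rfl⟩
    have hn' : (n : ℤ) ≠ 0 := by exact_mod_cast hn
    have h0 := Int.emod_nonneg k hn'
    have h1 := Int.emod_lt_of_pos k (by omega : (0 : ℤ) < n)
    refine ⟨⟨(k % n).toNat, by omega⟩, ?_⟩
    dsimp only
    rw [cis_pow, cis_eq_iff hn, Int.toNat_of_nonneg h0]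
    exact ⟨-(k / n), by linarith [Int.emod_add_mul_ediv k n]⟩

lemma convex_regularPolygon (n : ℕ) : Convex ℝ (regularPolygon n) := convex_convexHull _ _

lemma polygonVertices_subset (hn : n ≠ 0) : polygonVertices n ⊆ regularPolygon n :=
  regularPolygon_eq_convexHull hn ▸ subset_convexHull ℝ _

lemma norm_le_one (hn : n ≠ 0) {z : ℂ} (hz : z ∈ regularPolygon n) : ‖z‖ ≤ 1 := by
  rw [regularPolygon_eq_convexHull hn] at hz
  rw [← mem_closedBall_zero_iff]
  refine convexHull_min (fun w hw => ?_) (convex_closedBall _ _) hz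
  rw [mem_closedBall_zero_iff, norm_eq_one_of_mem_polygonVertices hw]

lemma proj_odd_le (hn : n ≠ 0) (t : ℤ) {z : ℂ} (hz : z ∈ regularPolygon n) :
    proj n (2 * t + 1) z ≤ (cis n 1).re := by
  rw [regularPolygon_eq_convexHull hn] at hz
  refine convexHull_min ?_ (convex_halfSpace_le (proj n (2 * t + 1)).isLinear _) hz
  rintro _ ⟨k, rfl⟩
  have h := cis_odd_re_le hn (k - t - 1)
  rwa [show 2 * (k - t - 1) + 1 = 2 * k - (2 * t + 1) by ring, ← proj_cis] at h

lemma exists_perp_nonneg_nonpos (hn : 3 ≤ n) (z : ℂ) :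
    ∃ t : ℤ, 0 ≤ perp n (2 * t) z ∧ perp n (2 * t + 2) z ≤ 0 := by
  have hθ : 0 < 2 * (Real.pi / n) := by positivity
  have hθ' : 2 * (Real.pi / n) ≤ Real.pi := by
    rw [← mul_div_assoc, div_le_iff₀ (by positivity), mul_comm]
    gcongr
    exact_mod_cast (by omega : 2 ≤ n)
  have perp_eq : ∀ s : ℤ, perp n s z = ‖z‖ * Real.sin (arg z - s * (Real.pi / n)) := by
    intro s
    rw [perp_apply, Real.sin_sub]
    simp only [cis]
    linear_combination (-Real.cos (s * (Real.pi / n))) * norm_mul_sin_arg z +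
      Real.sin (s * (Real.pi / n)) * norm_mul_cos_arg z
  set t := ⌊arg z / (2 * (Real.pi / n))⌋
  have h₁ : t * (2 * (Real.pi / n)) ≤ arg z := (le_div_iff₀ hθ).mp (Int.floor_le _)
  have h₂ : arg z < (t + 1) * (2 * (Real.pi / n)) := (div_lt_iff₀ hθ).mp (Int.lt_floor_add_one _)
  refine ⟨t, ?_, ?_⟩ <;> rw [perp_eq] <;> push_cast
  · exact mul_nonneg (norm_nonneg z)
      (Real.sin_nonneg_of_nonneg_of_le_pi (by linarith) (by linarith))
  · exact mul_nonpos_of_nonneg_of_nonpos (norm_nonneg z)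
      (Real.sin_nonpos_of_nonpos_of_neg_pi_le (by linarith) (by linarith))

lemma cis_two_im_smul (t : ℤ) (z : ℂ) : (cis n 2).im • z =
    perp n (2 * t) z • cis n (2 * t + 2) - perp n (2 * t + 2) z • cis n (2 * t) := by
  apply ext_proj_perp (n := n) (2 * t) <;>
    simp only [map_sub, map_smul, proj_cis, perp_cis, perp_eq_proj_perp (2 * t) (2 * t + 2),
      smul_eq_mul, sub_self, add_sub_cancel_left, cis_zero, one_re, one_im] <;> ring

lemma exists_sector (hn : 3 ≤ n) (z : ℂ) : ∃ (t : ℤ) (a b : ℝ), 0 ≤ a ∧ 0 ≤ b ∧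
    z = a • cis n (2 * t) + b • cis n (2 * t + 2) := by
  obtain ⟨t, h₁, h₂⟩ := exists_perp_nonneg_nonpos hn z
  have hs : 0 < (cis n 2).im := cis_im_pos two_pos (by omega)
  refine ⟨t, -perp n (2 * t + 2) z / (cis n 2).im, perp n (2 * t) z / (cis n 2).im,
    div_nonneg (by linarith) hs.le, div_nonneg h₁ hs.le, ?_⟩
  rw [← smul_right_injective ℂ hs.ne' |>.eq_iff]
  rw [cis_two_im_smul t z, smul_add, smul_smul, smul_smul, mul_div_cancel₀ _ hs.ne',
    mul_div_cancel₀ _ hs.ne']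
  module

lemma zero_mem_regularPolygon (hn : 3 ≤ n) : (0 : ℂ) ∈ regularPolygon n := by
  have hQ := convex_regularPolygon n
  have hv := polygonVertices_subset (n := n) (by omega)
  obtain ⟨t, a, b, ha, hb, h⟩ := exists_sector hn (-1)
  have hmem : cis n (2 * 0) + (a • cis n (2 * t) + b • cis n (2 * t + 2)) ∈
      (1 + (a + b)) • regularPolygon n := by
    rw [hQ.add_smul zero_le_one (by positivity), one_smul, hQ.add_smul ha hb]
    exact Set.add_mem_add (hv ⟨0, rfl⟩) (Set.add_mem_add
      (Set.smul_mem_smul_set (hv (cis_two_mul_mem_polygonVertices t)))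
      (Set.smul_mem_smul_set (hv (cis_two_mul_add_two_mem_polygonVertices t))))
  rw [← h, mul_zero, cis_zero, add_neg_cancel] at hmem
  exact (Set.zero_mem_smul_set_iff (by positivity)).mp hmem

lemma proj_add_smul_edge (t : ℤ) (a b : ℝ) :
    proj n (2 * t + 1) (a • cis n (2 * t) + b • cis n (2 * t + 2)) = (a + b) * (cis n 1).re := by
  rw [map_add, map_smul, map_smul, proj_cis, proj_cis, show 2 * t - (2 * t + 1) = -1 by ring,
    show 2 * t + 2 - (2 * t + 1) = 1 by ring, cis_neg_re, smul_eq_mul, smul_eq_mul, add_mul]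

lemma exists_smul_eq (hn : 3 ≤ n) (t : ℤ) {a b : ℝ} (ha : 0 ≤ a) (hb : 0 ≤ b) :
    ∃ y ∈ regularPolygon n, (a + b) • y = a • cis n (2 * t) + b • cis n (2 * t + 2) := by
  have hv := polygonVertices_subset (n := n) (by omega)
  rw [← Set.mem_smul_set, (convex_regularPolygon n).add_smul ha hb]
  exact Set.add_mem_add (Set.smul_mem_smul_set (hv (cis_two_mul_mem_polygonVertices t)))
    (Set.smul_mem_smul_set (hv (cis_two_mul_add_two_mem_polygonVertices t)))

lemma mem_regularPolygon_iff (hn : 3 ≤ n) (z : ℂ) :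
    z ∈ regularPolygon n ↔ ∀ t : ℤ, proj n (2 * t + 1) z ≤ (cis n 1).re := by
  refine ⟨fun hz t => proj_odd_le (by omega) t hz, fun h => ?_⟩
  obtain ⟨t, a, b, ha, hb, rfl⟩ := exists_sector hn z
  obtain ⟨y, hy, hyz⟩ := exists_smul_eq hn t ha hb
  have hab : a + b ≤ 1 := by
    have hproj := h t
    rw [proj_add_smul_edge] at hproj
    exact (mul_le_iff_le_one_left (cis_re_pos zero_le_one (by omega))).mp hproj
  rw [← hyz]
  exact (convex_regularPolygon n).smul_mem_of_zero_mem (zero_mem_regularPolygon hn) hy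
    ⟨by positivity, hab⟩

lemma zero_mem_interior_regularPolygon (hn : 3 ≤ n) : (0 : ℂ) ∈ interior (regularPolygon n) := by
  have hc : 0 < (cis n 1).re := cis_re_pos zero_le_one (by omega)
  refine mem_interior.mpr ⟨_, fun z hz => ?_, Metric.isOpen_ball, Metric.mem_ball_self hc⟩
  rw [mem_ball_zero_iff] at hz
  exact (mem_regularPolygon_iff hn z).mpr fun t =>
    ((le_abs_self _).trans (abs_proj_le _ z)).trans hz.le

lemma regularPolygon_trichotomy (hn : 3 ≤ n) {z : ℂ} (hz : z ∈ regularPolygon n) :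
    z ∈ polygonVertices n ∨ (∃ t, z ∈ openEdge n t) ∨ z ∈ interior (regularPolygon n) := by
  obtain ⟨t, a, b, ha, hb, h⟩ := exists_sector hn z
  have hc : 0 < (cis n 1).re := cis_re_pos zero_le_one (by omega)
  have hab : a + b ≤ 1 := by
    have hproj := proj_odd_le (by omega) t hz
    rw [h, proj_add_smul_edge] at hproj
    exact (mul_le_iff_le_one_left hc).mp hproj
  rcases hab.lt_or_eq with hlt | heq
  · obtain ⟨y, hy, hyz⟩ := exists_smul_eq hn t ha hb
    have hint := (convex_regularPolygon n).combo_interior_self_mem_interior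
      (zero_mem_interior_regularPolygon hn) hy (sub_pos.mpr hlt) (add_nonneg ha hb) (by ring)
    exact Or.inr (Or.inr (by simpa [h, hyz] using hint))
  · rcases ha.eq_or_lt with rfl | ha
    · obtain rfl : b = 1 := by linarith
      exact Or.inl (by simpa [h] using cis_two_mul_add_two_mem_polygonVertices t)
    · rcases hb.eq_or_lt with rfl | hb
      · obtain rfl : a = 1 := by linarith
        exact Or.inl (by simpa [h] using cis_two_mul_mem_polygonVertices t)
      · exact Or.inr (Or.inl ⟨t, a, b, ha, hb, heq, h.symm⟩)

lemma openEdge_subset (hn : n ≠ 0) (t : ℤ) : openEdge n t ⊆ regularPolygon n :=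
  (convex_regularPolygon n).openSegment_subset
    (polygonVertices_subset hn (cis_two_mul_mem_polygonVertices t))
    (polygonVertices_subset hn (cis_two_mul_add_two_mem_polygonVertices t))

lemma proj_eq_of_mem_openEdge {t : ℤ} {z : ℂ} (hz : z ∈ openEdge n t) :
    proj n (2 * t + 1) z = (cis n 1).re := by
  obtain ⟨a, b, -, -, hab, rfl⟩ := hz
  rw [proj_add_smul_edge, hab, one_mul]

lemma openEdge_add_mul (hn : n ≠ 0) (t k : ℤ) : openEdge n (t + n * k) = openEdge n t := by
  rw [openEdge, openEdge, ← cis_add_two_mul hn (2 * t) k, ← cis_add_two_mul hn (2 * t + 2) k]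
  ring_nf

lemma cis_two_mul_ne (hn : 3 ≤ n) (t : ℤ) : cis n (2 * t) ≠ cis n (2 * t + 2) := by
  rw [Ne, cis_eq_iff (by omega), show 2 * t - (2 * t + 2) = -2 by ring, dvd_neg]
  intro h
  have := Int.le_of_dvd two_pos h
  omega

lemma norm_lt_one_of_mem_openEdge (hn : 3 ≤ n) {t : ℤ} {z : ℂ} (hz : z ∈ openEdge n t) :
    ‖z‖ < 1 := by
  have h := (strictConvex_closedBall ℝ (0 : ℂ) 1).openSegment_subset (by simp) (by simp)
    (cis_two_mul_ne hn t) hz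
  rwa [interior_closedBall _ one_ne_zero, mem_ball_zero_iff] at h

lemma notMem_polygonVertices_of_mem_openEdge (hn : 3 ≤ n) {t : ℤ} {z : ℂ} (hz : z ∈ openEdge n t) :
    z ∉ polygonVertices n :=
  fun h => (norm_lt_one_of_mem_openEdge hn hz).ne (norm_eq_one_of_mem_polygonVertices h)

lemma mem_openEdge_of_norm_lt_one (hn : 3 ≤ n) {t : ℤ} {z : ℂ}
    (h : proj n (2 * t + 1) z = (cis n 1).re) (hz : ‖z‖ < 1) : z ∈ openEdge n t := by
  have hs : 0 < (cis n 1).im := cis_im_pos one_pos (by omega)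
  obtain ⟨hl, hr⟩ : -(cis n 1).im < perp n (2 * t + 1) z ∧ perp n (2 * t + 1) z < (cis n 1).im := by
    rw [← abs_lt]
    apply abs_lt_of_sq_lt_sq _ hs.le
    have hpyth := proj_sq_add_perp_sq (n := n) (2 * t + 1) z
    rw [h] at hpyth
    linarith [cis_sq_add_sq (n := n) 1, (sq_lt_one_iff₀ (norm_nonneg z)).mpr hz]
  refine ⟨((cis n 1).im - perp n (2 * t + 1) z) / (2 * (cis n 1).im),
    ((cis n 1).im + perp n (2 * t + 1) z) / (2 * (cis n 1).im),
    div_pos (by linarith) (by linarith), div_pos (by linarith) (by linarith),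
    by field_simp; ring, ?_⟩
  apply ext_proj_perp (n := n) (2 * t + 1)
  · rw [proj_add_smul_edge, h]
    field_simp
    ring
  · simp only [map_add, map_smul, perp_cis, show 2 * t - (2 * t + 1) = -1 by ring,
      show 2 * t + 2 - (2 * t + 1) = 1 by ring, cis_neg_im, smul_eq_mul]
    field_simp
    ring

lemma dvd_sub_of_proj_eq (hn : 3 ≤ n) {s t : ℤ} {z : ℂ} (hs : z ∈ openEdge n s)
    (h : proj n (2 * t + 1) z = (cis n 1).re) : (n : ℤ) ∣ s - t := by
  obtain ⟨a, b, ha, hb, hab, rfl⟩ := hs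
  have h₁ : (cis n (2 * (s - t - 1) + 1)).re ≤ (cis n 1).re := cis_odd_re_le (by omega) _
  have h₂ : (cis n (2 * (s - t) + 1)).re ≤ (cis n 1).re := cis_odd_re_le (by omega) _
  rw [map_add, map_smul, map_smul, proj_cis, proj_cis, smul_eq_mul, smul_eq_mul,
    show 2 * s - (2 * t + 1) = 2 * (s - t - 1) + 1 by ring,
    show 2 * s + 2 - (2 * t + 1) = 2 * (s - t) + 1 by ring] at h
  have h₁' : (cis n (2 * (s - t - 1) + 1)).re = (cis n 1).re := by
    apply h₁.eq_of_not_lt fun hlt => h.not_lt ?_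
    calc _ < a * (cis n 1).re + b * (cis n 1).re := add_lt_add_of_lt_of_le (by gcongr) (by gcongr)
      _ = _ := by rw [← add_mul, hab, one_mul]
  have h₂' : (cis n (2 * (s - t) + 1)).re = (cis n 1).re := by
    rw [h₁'] at h
    apply mul_left_cancel₀ hb.ne'
    linear_combination h - (cis n 1).re * hab
  rcases (cis_odd_re_eq_iff (by omega) _).mp h₂' with h | ⟨l, hl⟩
  · exact h
  · rcases (cis_odd_re_eq_iff (by omega) _).mp h₁' with ⟨k, hk⟩ | h
    · have h2 := Int.le_of_dvd two_pos (⟨l - k, by linarith⟩ : (n : ℤ) ∣ 2)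
      omega
    · simpa using h

end polygon

section freeDir

open Filter
open scoped Topology

variable {E : Type*} [AddCommGroup E] [Module ℝ E]

/-- `v` is a free direction of `A` at `x` if `x` can be moved a little both ways along `v` without
leaving `A`. The extreme points of a convex set are its points without free directions. -/
def FreeDir (A : Set E) (x v : E) : Prop := ∀ᶠ δ : ℝ in 𝓝 0, x + δ • v ∈ A

variable {A : Set E} {x v : E}

lemma FreeDir.smul (h : FreeDir A x v) (a : ℝ) : FreeDir A x (a • v) := by
  have hlim : Tendsto (fun δ : ℝ => δ * a) (𝓝 0) (𝓝 0) :=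
    (continuous_mul_const a).tendsto' 0 0 (zero_mul a)
  simpa only [FreeDir, smul_smul] using hlim.eventually h

lemma freeDir_zero (hx : x ∈ A) : FreeDir A x 0 := by simp [FreeDir, hx]

lemma FreeDir.exists_pos (h : FreeDir A x v) : ∃ δ : ℝ, 0 < δ ∧ x + δ • v ∈ A ∧ x - δ • v ∈ A := by
  obtain ⟨ε, hε, hball⟩ := Metric.eventually_nhds_iff.mp h
  refine ⟨ε / 2, half_pos hε, hball ?_, ?_⟩
  · rw [Real.dist_0_eq_abs, abs_of_pos (half_pos hε)]
    exact half_lt_self hε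
  · rw [sub_eq_add_neg, ← neg_smul]
    apply hball
    rw [Real.dist_0_eq_abs, abs_neg, abs_of_pos (half_pos hε)]
    exact half_lt_self hε

lemma freeDir_of_mem_openSegment (hA : Convex ℝ A) {y z : E} (hy : y ∈ A) (hz : z ∈ A)
    (hx : x ∈ openSegment ℝ y z) : FreeDir A x (z - y) := by
  obtain ⟨a, b, ha, hb, hab, rfl⟩ := hx
  filter_upwards [Ioo_mem_nhds (neg_lt_zero.mpr hb) ha] with δ ⟨hδb, hδa⟩
  have hmem := hA hy hz (a := a - δ) (b := b + δ) (by linarith) (by linarith) (by linarith)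
  convert hmem using 1
  module

lemma freeDir_of_mem_interior [TopologicalSpace E] [ContinuousAdd E] [ContinuousSMul ℝ E]
    (hx : x ∈ interior A) (v : E) : FreeDir A x v := by
  have hlim : Tendsto (fun δ : ℝ => x + δ • v) (𝓝 0) (𝓝 x) :=
    Continuous.tendsto' (by fun_prop) 0 x (by simp)
  exact hlim.eventually (mem_interior_iff_mem_nhds.mp hx)

lemma FreeDir.apply_eq_zero (h : FreeDir A x v) (l : E →ₗ[ℝ] ℝ) {c : ℝ} (hl : ∀ y ∈ A, l y ≤ c)
    (hx : l x = c) : l v = 0 := by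
  obtain ⟨δ, hδ, h₁, h₂⟩ := h.exists_pos
  have h₁ := hl _ h₁
  have h₂ := hl _ h₂
  rw [map_add, map_smul, smul_eq_mul, hx] at h₁
  rw [map_sub, map_smul, smul_eq_mul, hx] at h₂
  exact (mul_eq_zero.mp (by linarith)).resolve_left hδ.ne'

lemma mem_extremePoints_iff_freeDir (hA : Convex ℝ A) :
    x ∈ A.extremePoints ℝ ↔ x ∈ A ∧ ∀ v, FreeDir A x v → v = 0 := by
  constructor
  · refine fun hx => ⟨hx.1, fun v hv => ?_⟩
    obtain ⟨δ, hδ, h₁, h₂⟩ := hv.exists_pos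
    have hmid : x ∈ openSegment ℝ (x + δ • v) (x - δ • v) :=
      ⟨1 / 2, 1 / 2, by norm_num, by norm_num, by norm_num, by module⟩
    have heq := hx.2 h₁ h₂ hmid
    exact (smul_eq_zero.mp (add_eq_left.mp heq)).resolve_left hδ.ne'
  · refine fun ⟨hx, h⟩ => ⟨hx, fun y hy z hz hyz => ?_⟩
    have heq : z = y := sub_eq_zero.mp (h _ (freeDir_of_mem_openSegment hA hy hz hyz))
    rw [heq, openSegment_same] at hyz
    exact hyz.symm

end freeDir

section polygonFreeDir

variable {n : ℕ}

lemma FreeDir.eq_zero_of_mem_polygonVertices (hn : n ≠ 0) {z v : ℂ}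
    (h : FreeDir (regularPolygon n) z v) (hz : z ∈ polygonVertices n) : v = 0 := by
  obtain ⟨δ, hδ, h₁, h₂⟩ := h.exists_pos
  have hpar := parallelogram_law_with_norm ℝ z (δ • v)
  rw [norm_eq_one_of_mem_polygonVertices hz] at hpar
  have hδv : ‖δ • v‖ = 0 := by
    nlinarith [norm_le_one hn h₁, norm_le_one hn h₂, norm_nonneg (z + δ • v),
      norm_nonneg (z - δ • v), mul_self_nonneg ‖δ • v‖]
  exact (smul_eq_zero.mp (norm_eq_zero.mp hδv)).resolve_left hδ.ne'

lemma FreeDir.proj_eq_zero_of_mem_openEdge (hn : n ≠ 0) {t : ℤ} {z v : ℂ}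
    (h : FreeDir (regularPolygon n) z v) (hz : z ∈ openEdge n t) : proj n (2 * t + 1) v = 0 :=
  h.apply_eq_zero _ (fun _ => proj_odd_le hn t) (proj_eq_of_mem_openEdge hz)

lemma freeDir_of_mem_openEdge (hn : 3 ≤ n) {t : ℤ} {z : ℂ} (hz : z ∈ openEdge n t) :
    FreeDir (regularPolygon n) z (I * cis n (2 * t + 1)) := by
  have hv := polygonVertices_subset (n := n) (by omega)
  have hs : 2 * (cis n 1).im ≠ 0 := (mul_pos two_pos (cis_im_pos one_pos (by omega))).ne'
  have hfree := (freeDir_of_mem_openSegment (convex_regularPolygon n)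
    (hv (cis_two_mul_mem_polygonVertices t)) (hv (cis_two_mul_add_two_mem_polygonVertices t))
    hz).smul (2 * (cis n 1).im)⁻¹
  have hchord := cis_add_sub_cis_sub (n := n) (2 * t + 1) 1
  rw [add_sub_cancel_right, show 2 * t + 1 + 1 = 2 * t + 2 by ring] at hchord
  rwa [hchord, smul_smul, inv_mul_cancel₀ hs, one_smul] at hfree

lemma planeDet_I_mul_cis (s t : ℤ) :
    planeDet (I * cis n s) (I * cis n t) = (cis n (t - s)).im := by
  simp only [planeDet, I_mul_re, I_mul_im, sub_eq_add_neg, cis_add_im, cis_neg_re, cis_neg_im]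
  ring

lemma planeDet_edgeDir_ne_zero (hn : n ≠ 0) {s t : ℤ} (hst : ¬ (n : ℤ) ∣ 2 * (s - t)) :
    planeDet (I * cis n (2 * s + 1)) (I * cis n (2 * t + 1)) ≠ 0 := by
  rw [planeDet_I_mul_cis, Ne, cis_im_eq_zero_iff hn, ← dvd_neg,
    show -(2 * t + 1 - (2 * s + 1)) = 2 * (s - t) by ring]
  exact hst

lemma eq_zero_of_proj_eq_zero (hn : n ≠ 0) {s t : ℤ} (hst : ¬ (n : ℤ) ∣ 2 * (s - t)) {z : ℂ}
    (hs : proj n (2 * s + 1) z = 0) (ht : proj n (2 * t + 1) z = 0) : z = 0 := by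
  rw [proj_eq_proj_perp (2 * t + 1), ht, zero_mul, zero_add, mul_eq_zero, cis_im_eq_zero_iff hn,
    show 2 * s + 1 - (2 * t + 1) = 2 * (s - t) by ring, or_iff_left hst] at hs
  exact ext_proj_perp (2 * t + 1) (ht.trans (map_zero _).symm) (hs.trans (map_zero _).symm)

lemma freeDir_of_mem_openEdge_of_parallel (hn : 3 ≤ n) {s t : ℤ} (hst : (n : ℤ) ∣ 2 * (s - t))
    {z : ℂ} (hz : z ∈ openEdge n t) : FreeDir (regularPolygon n) z (I * cis n (2 * s + 1)) := by
  have hfree := freeDir_of_mem_openEdge hn hz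
  have hsin : (cis n (2 * (s - t))).im = 0 := (cis_im_eq_zero_iff (by omega) _).mpr hst
  have hdir : I * cis n (2 * s + 1) = (cis n (2 * (s - t))).re • (I * cis n (2 * t + 1)) := by
    rw [show 2 * s + 1 = 2 * (s - t) + (2 * t + 1) by ring, cis_add]
    apply Complex.ext <;> simp [hsin]
  exact hdir ▸ hfree.smul _

end polygonFreeDir

/-- The images of the vertices `1, I, -1, -I` of the square under an affine map of the plane.
This quadruple determines the map and turns `Hom(P₄, Pₙ)` into the set of parallelograms with all
corners in `Pₙ`. -/
def squareTuple : (ℂ →ᵃ[ℝ] ℂ) →ₗ[ℝ] (Fin 4 → ℂ) where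
  toFun f i := f (I ^ (i : ℕ))
  map_add' _ _ := rfl
  map_smul' _ _ := rfl

section squareTuple

lemma squareTuple_apply (f : ℂ →ᵃ[ℝ] ℂ) (i : Fin 4) : squareTuple f i = f (I ^ (i : ℕ)) := rfl

lemma affineMap_apply_eq (f : ℂ →ᵃ[ℝ] ℂ) (z : ℂ) :
    f z = f 0 + z.re • f.linear 1 + z.im • f.linear I := by
  have hz : z.re • (1 : ℂ) + z.im • I = z := by apply Complex.ext <;> simp
  have hf : f z = f.linear z + f 0 := by simpa using f.map_vadd 0 z
  rw [hf, add_assoc, ← map_smul, ← map_smul, ← map_add, hz, add_comm]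

lemma squareTuple_eq (f : ℂ →ᵃ[ℝ] ℂ) : squareTuple f =
    ![f 0 + f.linear 1, f 0 + f.linear I, f 0 - f.linear 1, f 0 - f.linear I] := by
  funext i
  rw [squareTuple_apply, affineMap_apply_eq]
  fin_cases i <;> simp [pow_succ, sub_eq_add_neg]

lemma squareTuple_add_eq_add (f : ℂ →ᵃ[ℝ] ℂ) :
    squareTuple f 0 + squareTuple f 2 = squareTuple f 1 + squareTuple f 3 := by
  simp [squareTuple_eq]

lemma squareTuple_injective : Function.Injective squareTuple := by
  refine (injective_iff_map_eq_zero _).mpr fun f hf => ?_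
  rw [squareTuple_eq] at hf
  have h0 := congrFun hf 0
  have h1 := congrFun hf 1
  have h2 := congrFun hf 2
  have h3 := congrFun hf 3
  simp only [Matrix.cons_val, Pi.zero_apply] at h0 h1 h2 h3
  have hc : f 0 = 0 := by linear_combination (h0 + h2) / 2
  have hu : f.linear 1 = 0 := by linear_combination (h0 - h2) / 2
  have hv : f.linear I = 0 := by linear_combination (h1 - h3) / 2
  ext z
  simp [affineMap_apply_eq f z, hc, hu, hv]

lemma exists_squareTuple_eq {x : Fin 4 → ℂ} (hx : x 0 + x 2 = x 1 + x 3) :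
    ∃ f, squareTuple f = x := by
  let L : ℂ →ₗ[ℝ] ℂ := reLm.smulRight ((x 0 - x 2) / 2) + imLm.smulRight ((x 1 - x 3) / 2)
  let f : ℂ →ᵃ[ℝ] ℂ := L.toAffineMap + AffineMap.const ℝ ℂ ((x 0 + x 2) / 2)
  have hf0 : f 0 = (x 0 + x 2) / 2 := by simp [f]
  have hf1 : f.linear 1 = (x 0 - x 2) / 2 := by simp [f, L]
  have hfI : f.linear I = (x 1 - x 3) / 2 := by simp [f, L]
  refine ⟨f, ?_⟩
  rw [squareTuple_eq, hf0, hf1, hfI]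
  funext i
  fin_cases i
  · change (x 0 + x 2) / 2 + (x 0 - x 2) / 2 = x 0
    ring
  · change (x 0 + x 2) / 2 + (x 1 - x 3) / 2 = x 1
    rw [hx]
    ring
  · change (x 0 + x 2) / 2 - (x 0 - x 2) / 2 = x 2
    ring
  · change (x 0 + x 2) / 2 - (x 1 - x 3) / 2 = x 3
    rw [hx]
    ring

lemma regularPolygon_four :
    regularPolygon 4 = convexHull ℝ (Set.range fun k : Fin 4 => I ^ (k : ℕ)) := by
  have h : 2 * Real.pi / (4 : ℕ) = Real.pi / 2 := by push_cast; ring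
  unfold regularPolygon
  congr 2
  funext k
  rw [h]
  simp

lemma mem_homPolytope_iff {Q : Set ℂ} (hQ : Convex ℝ Q) (f : ℂ →ᵃ[ℝ] ℂ) :
    f ∈ homPolytope (regularPolygon 4) Q ↔ ∀ i, squareTuple f i ∈ Q := by
  rw [homPolytope, Set.mem_ofPred_eq, Set.mapsTo_iff_image_subset, regularPolygon_four,
    AffineMap.image_convexHull, hQ.convexHull_subset_iff, ← Set.range_comp, Set.range_subset_iff]
  rfl

lemma convex_homPolytope (P : Set ℂ) {Q : Set ℂ} (hQ : Convex ℝ Q) :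
    Convex ℝ (homPolytope P Q) := fun _ hf _ hg _ _ ha hb hab _ hz =>
  hQ (hf hz) (hg hz) ha hb hab

lemma freeDir_homPolytope_iff {Q : Set ℂ} (hQ : Convex ℝ Q) (f g : ℂ →ᵃ[ℝ] ℂ) :
    FreeDir (homPolytope (regularPolygon 4) Q) f g ↔
      ∀ i, FreeDir Q (squareTuple f i) (squareTuple g i) := by
  simp only [FreeDir, mem_homPolytope_iff hQ, map_add, map_smul, Pi.add_apply, Pi.smul_apply,
    Filter.eventually_all]

lemma vectorSpan_regularPolygon_four : vectorSpan ℝ (regularPolygon 4) = ⊤ := by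
  rw [regularPolygon_four, ← direction_affineSpan, affineSpan_convexHull, direction_affineSpan,
    eq_top_iff]
  intro z _
  have h₁ := vsub_mem_vectorSpan ℝ (s := Set.range fun k : Fin 4 => I ^ (k : ℕ)) ⟨0, rfl⟩ ⟨2, rfl⟩
  have h₂ := vsub_mem_vectorSpan ℝ (s := Set.range fun k : Fin 4 => I ^ (k : ℕ)) ⟨1, rfl⟩ ⟨3, rfl⟩
  convert Submodule.add_mem _ (Submodule.smul_mem _ (z.re / 2) h₁)
    (Submodule.smul_mem _ (z.im / 2) h₂) using 1
  apply Complex.ext <;> simp [pow_succ]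

lemma det_eq_planeDet (L : ℂ →ₗ[ℝ] ℂ) : LinearMap.det L = planeDet (L 1) (L I) := by
  rw [← LinearMap.det_toMatrix basisOneI, Matrix.det_fin_two]
  simp only [LinearMap.toMatrix_apply, coe_basisOneI, coe_basisOneI_repr, Matrix.cons_val, planeDet]
  ring

lemma mapRank_regularPolygon_four_eq_two_iff (f : ℂ →ᵃ[ℝ] ℂ) :
    mapRank (regularPolygon 4) f = 2 ↔
      planeDet (squareTuple f 0 - squareTuple f 1) (squareTuple f 2 - squareTuple f 1) ≠ 0 := by
  have hdet : planeDet (squareTuple f 0 - squareTuple f 1) (squareTuple f 2 - squareTuple f 1) =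
      -2 * LinearMap.det f.linear := by
    simp only [squareTuple_eq, det_eq_planeDet, planeDet, Matrix.cons_val, sub_re, sub_im, add_re,
      add_im]
    ring
  have hker : LinearMap.det f.linear ≠ 0 ↔ LinearMap.ker f.linear = ⊥ :=
    LinearMap.det_eq_zero_iff_ker_ne_bot.not_left
  have hrank := f.linear.finrank_range_add_finrank_ker
  rw [finrank_real_complex] at hrank
  rw [hdet, mul_ne_zero_iff_left (by norm_num), hker, ← Submodule.finrank_eq_zero (R := ℝ),
    mapRank, ← AffineMap.map_vectorSpan, vectorSpan_regularPolygon_four, Submodule.map_top]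
  omega

end squareTuple

/-- A quadruple of points of the regular `n`-gon is rigid if its points have no free directions
summing to zero, except zero directions. Up to the signs `1, -1, 1, -1` of the directions this says
that a parallelogram has no free deformation into parallelograms. -/
def IsRigid (n : ℕ) (x : Fin 4 → ℂ) : Prop :=
  ∀ w : Fin 4 → ℂ, (∀ i, FreeDir (regularPolygon n) (x i) (w i)) → ∑ i, w i = 0 → w = 0

/-- The corners, in order, of the nondegenerate rigid parallelograms in the regular `n`-gon. They
correspond to the vertices of rank two of `Hom(P₄, Pₙ)`. -/
def vertexTuples (n : ℕ) : Set (Fin 4 → ℂ) :=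
  {x | (∀ i, x i ∈ regularPolygon n) ∧ x 0 + x 2 = x 1 + x 3 ∧ IsRigid n x ∧
    planeDet (x 0 - x 1) (x 2 - x 1) ≠ 0}

section rigid

variable {n : ℕ}

lemma sum_alternating_eq_zero_iff (w : Fin 4 → ℂ) :
    ∑ i : Fin 4, (-1 : ℝ) ^ (i : ℕ) • w i = 0 ↔ w 0 + w 2 = w 1 + w 3 := by
  have hsum : ∑ i : Fin 4, (-1 : ℝ) ^ (i : ℕ) • w i = w 0 + w 2 - (w 1 + w 3) := by
    simp only [Fin.sum_univ_four, Fin.coe_ofNat_eq_mod, Nat.zero_mod, Nat.one_mod, Nat.reduceMod,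
      Nat.mod_succ, pow_succ, pow_zero, one_smul, mul_neg, mul_one, neg_smul, neg_neg]
    ring
  rw [hsum, sub_eq_zero]

lemma mem_extremePoints_homPolytope_iff (f : ℂ →ᵃ[ℝ] ℂ) :
    f ∈ (homPolytope (regularPolygon 4) (regularPolygon n)).extremePoints ℝ ↔
      (∀ i, squareTuple f i ∈ regularPolygon n) ∧ IsRigid n (squareTuple f) := by
  have hQ := convex_regularPolygon n
  rw [mem_extremePoints_iff_freeDir (convex_homPolytope _ hQ), mem_homPolytope_iff hQ]
  simp only [freeDir_homPolytope_iff hQ]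
  refine and_congr_right fun _ => ⟨fun h w hw hsum => ?_, fun h g hg => ?_⟩
  · let w' : Fin 4 → ℂ := fun i => (-1 : ℝ) ^ (i : ℕ) • w i
    have htwist : ∀ i : Fin 4, (-1 : ℝ) ^ (i : ℕ) • (-1 : ℝ) ^ (i : ℕ) • w i = w i := fun i => by
      rw [smul_smul, ← mul_pow, neg_one_mul, neg_neg, one_pow, one_smul]
    obtain ⟨g, hg⟩ := exists_squareTuple_eq ((sum_alternating_eq_zero_iff w').mp
      (by simpa only [w', htwist] using hsum))
    have hg0 : g = 0 := h g fun i => by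
      rw [hg]
      exact (hw i).smul _
    funext i
    have hi : w' i = 0 := by simpa [hg0] using (congrFun hg i).symm
    rw [← htwist i, show (-1 : ℝ) ^ (i : ℕ) • w i = 0 from hi, smul_zero, Pi.zero_apply]
  · have hw := h (fun i => (-1 : ℝ) ^ (i : ℕ) • squareTuple g i) (fun i => (hg i).smul _)
      ((sum_alternating_eq_zero_iff _).mpr (squareTuple_add_eq_add g))
    apply squareTuple_injective
    funext i
    simpa using congrFun hw i

lemma image_squareTuple_verticesOfRank_two (n : ℕ) :
    squareTuple '' verticesOfRank (regularPolygon 4) (regularPolygon n) 2 = vertexTuples n := by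
  ext x
  constructor
  · rintro ⟨f, ⟨hf, hrank⟩, rfl⟩
    rw [mem_extremePoints_homPolytope_iff] at hf
    exact ⟨hf.1, squareTuple_add_eq_add f, hf.2,
      (mapRank_regularPolygon_four_eq_two_iff f).mp hrank⟩
  · rintro ⟨hmem, hpar, hrigid, hdet⟩
    obtain ⟨f, rfl⟩ := exists_squareTuple_eq hpar
    exact ⟨f, ⟨(mem_extremePoints_homPolytope_iff f).mpr ⟨hmem, hrigid⟩,
      (mapRank_regularPolygon_four_eq_two_iff f).mpr hdet⟩, rfl⟩

lemma IsRigid.eq_zero_of_three {x : Fin 4 → ℂ} (h : IsRigid n x)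
    (hx : ∀ i, x i ∈ regularPolygon n) {p q r : Fin 4} (hpq : p ≠ q) (hpr : p ≠ r) (hqr : q ≠ r)
    {u v w : ℂ} (hu : FreeDir (regularPolygon n) (x p) u)
    (hv : FreeDir (regularPolygon n) (x q) v) (hw : FreeDir (regularPolygon n) (x r) w)
    (hsum : u + v + w = 0) : u = 0 := by
  have hzero := h (Pi.single p u + Pi.single q v + Pi.single r w) (fun i => ?_) ?_
  · simpa [hpq, hpr] using congrFun hzero p
  · by_cases hip : i = p
    · subst hip; simpa [hpq, hpr] using hu
    by_cases hiq : i = q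
    · subst hiq; simpa [hip, hqr] using hv
    by_cases hir : i = r
    · subst hir; simpa [hip, hiq] using hw
    · simpa [hip, hiq, hir] using freeDir_zero (hx i)
  · simpa [Finset.sum_add_distrib] using hsum

lemma IsRigid.eq_zero_of_two {x : Fin 4 → ℂ} (h : IsRigid n x)
    (hx : ∀ i, x i ∈ regularPolygon n) {p q : Fin 4} (hpq : p ≠ q) {u : ℂ}
    (hp : FreeDir (regularPolygon n) (x p) u) (hq : FreeDir (regularPolygon n) (x q) u) :
    u = 0 := by
  have third : ∀ p q : Fin 4, ∃ r, p ≠ r ∧ q ≠ r := by decide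
  obtain ⟨r, hpr, hqr⟩ := third p q
  exact h.eq_zero_of_three hx hpq hpr hqr hp (by simpa using hq.smul (-1)) (freeDir_zero (hx r))
    (by simp)

lemma I_mul_cis_ne_zero (s : ℤ) : I * cis n s ≠ 0 := by
  rw [← norm_ne_zero_iff, norm_mul, norm_I, norm_cis, one_mul]
  exact one_ne_zero

lemma IsRigid.exists_openEdges (hn : 3 ≤ n) {x : Fin 4 → ℂ} (h : IsRigid n x)
    (hx : ∀ i, x i ∈ regularPolygon n) {p q : Fin 4} (hpq : p ≠ q)
    (hp : x p ∉ polygonVertices n) (hq : x q ∉ polygonVertices n) :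
    ∃ s t : ℤ, x p ∈ openEdge n s ∧ x q ∈ openEdge n t ∧ ¬ (n : ℤ) ∣ 2 * (s - t) := by
  have hfree {s : ℤ} (hp : FreeDir (regularPolygon n) (x p) (I * cis n (2 * s + 1)))
      (hq : FreeDir (regularPolygon n) (x q) (I * cis n (2 * s + 1))) : False :=
    I_mul_cis_ne_zero _ (h.eq_zero_of_two hx hpq hp hq)
  rcases (regularPolygon_trichotomy hn (hx p)).resolve_left hp with ⟨s, hs⟩ | hp
  · rcases (regularPolygon_trichotomy hn (hx q)).resolve_left hq with ⟨t, ht⟩ | hq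
    · exact ⟨s, t, hs, ht, fun hst => hfree (freeDir_of_mem_openEdge hn hs)
        (freeDir_of_mem_openEdge_of_parallel hn hst ht)⟩
    · exact (hfree (freeDir_of_mem_openEdge hn hs) (freeDir_of_mem_interior hq _)).elim
  · rcases (regularPolygon_trichotomy hn (hx q)).resolve_left hq with ⟨t, ht⟩ | hq
    · exact (hfree (freeDir_of_mem_interior hp _) (freeDir_of_mem_openEdge hn ht)).elim
    · exact (hfree (s := 0) (freeDir_of_mem_interior hp _) (freeDir_of_mem_interior hq _)).elim

lemma planeDet_smul_cyclic_sum (a b c : ℂ) :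
    planeDet b c • a + planeDet c a • b + planeDet a b • c = 0 := by
  apply Complex.ext <;>
    simp only [planeDet, add_re, add_im, smul_re, smul_im, smul_eq_mul, zero_re, zero_im] <;> ring

lemma IsRigid.mem_polygonVertices (hn : 3 ≤ n) {x : Fin 4 → ℂ} (h : IsRigid n x)
    (hx : ∀ i, x i ∈ regularPolygon n) {p q r : Fin 4} (hpq : p ≠ q) (hpr : p ≠ r) (hqr : q ≠ r)
    (hp : x p ∉ polygonVertices n) (hq : x q ∉ polygonVertices n) : x r ∈ polygonVertices n := by
  by_contra hr
  obtain ⟨s, -, hs, -, -⟩ := h.exists_openEdges hn hx hpq hp hq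
  obtain ⟨t, u, ht, hu, hdvd⟩ := h.exists_openEdges hn hx hqr hq hr
  have hzero := h.eq_zero_of_three hx hpq hpr hqr ((freeDir_of_mem_openEdge hn hs).smul _)
    ((freeDir_of_mem_openEdge hn ht).smul _) ((freeDir_of_mem_openEdge hn hu).smul _)
    (planeDet_smul_cyclic_sum _ _ _)
  exact smul_ne_zero (planeDet_edgeDir_ne_zero (by omega) hdvd) (I_mul_cis_ne_zero _) hzero

lemma isRigid_of_three_vertices (hn : n ≠ 0) {x : Fin 4 → ℂ} (h0 : x 0 ∈ polygonVertices n)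
    (h1 : x 1 ∈ polygonVertices n) (h2 : x 2 ∈ polygonVertices n) : IsRigid n x := by
  intro w hw hsum
  have hw0 := (hw 0).eq_zero_of_mem_polygonVertices hn h0
  have hw1 := (hw 1).eq_zero_of_mem_polygonVertices hn h1
  have hw2 := (hw 2).eq_zero_of_mem_polygonVertices hn h2
  have hw3 : w 3 = 0 := by simpa [Fin.sum_univ_four, hw0, hw1, hw2] using hsum
  funext i
  fin_cases i <;> assumption

lemma isRigid_of_two_vertices (hn : n ≠ 0) {x : Fin 4 → ℂ} {s t : ℤ}
    (h0 : x 0 ∈ polygonVertices n) (h1 : x 1 ∈ polygonVertices n) (h2 : x 2 ∈ openEdge n s)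
    (h3 : x 3 ∈ openEdge n t) (hst : ¬ (n : ℤ) ∣ 2 * (s - t)) : IsRigid n x := by
  intro w hw hsum
  have hw0 := (hw 0).eq_zero_of_mem_polygonVertices hn h0
  have hw1 := (hw 1).eq_zero_of_mem_polygonVertices hn h1
  have hw23 : w 2 = -w 3 := by
    simpa [Fin.sum_univ_four, hw0, hw1, add_eq_zero_iff_eq_neg] using hsum
  have hs := (hw 2).proj_eq_zero_of_mem_openEdge hn h2
  have ht := (hw 3).proj_eq_zero_of_mem_openEdge hn h3
  rw [hw23, map_neg, neg_eq_zero] at hs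
  have hw3 : w 3 = 0 := eq_zero_of_proj_eq_zero hn hst hs ht
  have hw2 : w 2 = 0 := by rw [hw23, hw3, neg_zero]
  funext i
  fin_cases i <;> assumption

end rigid

section geometry

variable {n : ℕ}

lemma cis_two_mul_sub_cis_two_mul (s t : ℤ) :
    cis n (2 * s) - cis n (2 * t) = (2 * (cis n (s - t)).im) • (I * cis n (s + t)) := by
  rw [← cis_add_sub_cis_sub]
  ring_nf

lemma cis_add_cis_sub_cis_mem (hn : 3 ≤ n) (k : ℤ) {j m : ℤ} (hj : 0 ≤ j) (hjm : j ≤ m)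
    (hm : 2 * m ≤ n) :
    cis n (2 * k) + cis n (2 * (k + m)) - cis n (2 * (k + j)) ∈ regularPolygon n := by
  have hv := polygonVertices_subset (n := n) (by omega)
  rcases hjm.eq_or_lt with rfl | hjm
  · rw [add_sub_cancel_right]
    exact hv (cis_two_mul_mem_polygonVertices k)
  have hpos : 0 < (cis n (m - j)).im := cis_im_pos (by omega) (by omega)
  have hle : (cis n (m - j)).im ≤ (cis n (m + j)).im := cis_im_le (by omega) (by omega) (by omega)
  have hchord : cis n (2 * (k + m)) - cis n (2 * (k + j)) =
      ((cis n (m - j)).im / (cis n (m + j)).im) • (cis n (2 * (k + m + j)) - cis n (2 * k)) := by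
    rw [cis_two_mul_sub_cis_two_mul, cis_two_mul_sub_cis_two_mul, smul_smul,
      show k + m - (k + j) = m - j by ring, show k + m + j - k = m + j by ring,
      show k + m + (k + j) = k + m + j + k by ring]
    congr 1
    field_simp [(hpos.trans_le hle).ne']
  rw [add_sub_assoc, hchord]
  exact (convex_regularPolygon n).add_smul_sub_mem (hv (cis_two_mul_mem_polygonVertices k))
    (hv (cis_two_mul_mem_polygonVertices _))
    ⟨div_nonneg hpos.le (hpos.trans_le hle).le, div_le_one_of_le₀ hle (hpos.trans_le hle).le⟩

/-- The fourth corner of the parallelogram with adjacent sides from the vertex `k` of the regular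
`n`-gon to the vertices `k + p` and `k + q`. -/
def oppositeCorner (n : ℕ) (k p q : ℤ) : ℂ :=
  cis n (2 * (k + p)) + cis n (2 * (k + q)) - cis n (2 * k)

lemma oppositeCorner_comm (k p q : ℤ) : oppositeCorner n k p q = oppositeCorner n k q p := by
  rw [oppositeCorner, oppositeCorner, add_comm (cis n _)]

lemma norm_oppositeCorner_sq (k p q : ℤ) : ‖oppositeCorner n k p q‖ ^ 2 =
    1 + 8 * ((cis n p).im * (cis n q).im) * (cis n (p - q)).re := by
  rw [← proj_sq_add_perp_sq (n := n) (2 * k + p + q), oppositeCorner]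
  simp only [map_add, map_sub, proj_cis, perp_cis]
  rw [show 2 * (k + p) - (2 * k + p + q) = p - q by ring,
    show 2 * (k + q) - (2 * k + p + q) = -(p - q) by ring,
    show 2 * k - (2 * k + p + q) = -(p + q) by ring, cis_neg_re, cis_neg_im, cis_neg_re, cis_neg_im]
  have hdiff : (cis n (p - q)).re - (cis n (p + q)).re = 2 * ((cis n p).im * (cis n q).im) := by
    rw [sub_eq_add_neg p, cis_add_re, cis_add_re, cis_neg_re, cis_neg_im]
    ring
  linear_combination cis_sq_add_sq (n := n) (p + q) + 4 * (cis n (p - q)).re * hdiff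

lemma oppositeCorner_mem_of_le (hn : 3 ≤ n) (k : ℤ) {p q : ℤ} (hq : 0 ≤ q) (hp : p ≤ n)
    (h : n ≤ 2 * (p - q)) : oppositeCorner n k p q ∈ regularPolygon n := by
  have hmem := cis_add_cis_sub_cis_mem hn (k + p) (j := n - p) (m := n - p + q) (by omega)
    (by omega) (by omega)
  have hturn (s : ℤ) : cis n (2 * (s + n)) = cis n (2 * s) := by
    rw [← cis_add_two_mul (by omega) (2 * s) 1]
    ring_nf
  rwa [show k + p + (n - p + q) = k + q + n by ring, hturn,
    show k + p + (n - p) = k + n by ring, hturn] at hmem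

lemma oppositeCorner_mem_iff (hn : 3 ≤ n) (k : ℤ) {p q : ℤ} (hp : p ∈ Set.Ioo 0 (n : ℤ))
    (hq : q ∈ Set.Ioo 0 (n : ℤ)) :
    oppositeCorner n k p q ∈ regularPolygon n ↔ n ≤ 2 * |p - q| := by
  obtain ⟨hp0, hpn⟩ := hp
  obtain ⟨hq0, hqn⟩ := hq
  constructor
  · intro h
    by_contra! hlt
    have hcos : 0 < (cis n |p - q|).re := cis_re_pos (abs_nonneg _) hlt
    have hsin := mul_pos (cis_im_pos hp0 hpn) (cis_im_pos hq0 hqn)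
    have hnorm := (sq_le_one_iff₀ (norm_nonneg _)).mpr (norm_le_one (by omega) h)
    rw [norm_oppositeCorner_sq, ← cis_abs_re] at hnorm
    linarith [mul_pos (mul_pos (by norm_num : (0 : ℝ) < 8) hsin) hcos]
  · intro h
    rcases abs_choice (p - q) with habs | habs <;> rw [habs] at h
    · exact oppositeCorner_mem_of_le hn k hq0.le hpn.le h
    · rw [oppositeCorner_comm]
      exact oppositeCorner_mem_of_le hn k hp0.le hqn.le (by omega)

lemma oppositeCorner_mem_polygonVertices (hn : n ≠ 0) (k : ℤ) {p q : ℤ} (h : n = 2 * |p - q|) :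
    oppositeCorner n k p q ∈ polygonVertices n := by
  wlog hpq : q ≤ p generalizing p q
  · rw [oppositeCorner_comm]
    exact this (by rwa [abs_sub_comm]) (by omega)
  rw [abs_of_nonneg (by omega)] at h
  refine ⟨k + (p - q), ?_⟩
  dsimp only
  rw [oppositeCorner, show 2 * (k + p) = 2 * (k + q) + n by linarith,
    show 2 * (k + (p - q)) = 2 * k + n by linarith, cis_add_self hn, cis_add_self hn]
  ring

lemma oppositeCorner_mem_polygonVertices_iff (hn : 3 ≤ n) (k : ℤ) {p q : ℤ}
    (hp : p ∈ Set.Ioo 0 (n : ℤ)) (hq : q ∈ Set.Ioo 0 (n : ℤ)) :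
    oppositeCorner n k p q ∈ polygonVertices n ↔ n = 2 * |p - q| := by
  refine ⟨fun h => ?_, oppositeCorner_mem_polygonVertices (by omega) k⟩
  have hle := (oppositeCorner_mem_iff hn k hp hq).mp (polygonVertices_subset (by omega) h)
  have hnorm := norm_oppositeCorner_sq (n := n) k p q
  rw [norm_eq_one_of_mem_polygonVertices h, ← cis_abs_re] at hnorm
  obtain ⟨hp0, hpn⟩ := hp
  obtain ⟨hq0, hqn⟩ := hq
  refine hle.eq_of_not_lt fun hlt => ?_
  have hcos : (cis n |p - q|).re < 0 := cis_re_neg hlt (by rw [abs_le]; omega)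
  have hsin := mul_pos (cis_im_pos hp0 hpn) (cis_im_pos hq0 hqn)
  linarith [mul_neg_of_pos_of_neg (mul_pos (by norm_num : (0 : ℝ) < 8) hsin) hcos]

lemma planeDet_sub_cis_sub_cis (k p q : ℤ) :
    planeDet (cis n (2 * (k + p)) - cis n (2 * k)) (cis n (2 * (k + q)) - cis n (2 * k)) =
      4 * ((cis n p).im * (cis n q).im * (cis n (q - p)).im) := by
  have hdet := planeDet_I_mul_cis (n := n) (k + p + k) (k + q + k)
  rw [add_sub_add_right_eq_sub, add_sub_add_left_eq_sub] at hdet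
  rw [cis_two_mul_sub_cis_two_mul, cis_two_mul_sub_cis_two_mul, add_sub_cancel_left,
    add_sub_cancel_left, ← hdet]
  simp only [planeDet, smul_re, smul_im, smul_eq_mul]
  ring

end geometry

section opposite

variable {n : ℕ}

lemma exists_cis_two_mul_eq (hn : n ≠ 0) (k l : ℤ) :
    ∃ m : ℤ, 0 ≤ m ∧ m < n ∧ cis n (2 * l) = cis n (2 * (k + m)) := by
  have hn' : (0 : ℤ) < n := by positivity
  refine ⟨(l - k) % n, Int.emod_nonneg _ hn'.ne', Int.emod_lt_of_pos _ hn', ?_⟩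
  rw [cis_eq_iff hn]
  exact ⟨(l - k) / n, by linarith [Int.emod_add_mul_ediv (l - k) n]⟩

lemma exists_mem_openEdge_add (hn : n ≠ 0) (k : ℤ) {t : ℤ} {z : ℂ} (hz : z ∈ openEdge n t) :
    ∃ j : ℤ, 0 ≤ j ∧ j < n ∧ z ∈ openEdge n (k + j) := by
  have hn' : (0 : ℤ) < n := by positivity
  refine ⟨(t - k) % n, Int.emod_nonneg _ hn'.ne', Int.emod_lt_of_pos _ hn', ?_⟩
  rwa [← openEdge_add_mul hn _ ((t - k) / n), add_assoc, Int.emod_add_mul_ediv, add_sub_cancel]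

lemma proj_le_of_mem_openEdge {k j m : ℤ} (hm : 0 ≤ m) (hmj : m ≤ j) (hj : j < n) {z : ℂ}
    (hz : z ∈ openEdge n (k + j)) : proj n (2 * k + m) z ≤ (cis n m).re := by
  have hn : n ≠ 0 := by omega
  have hend {i : ℤ} (hi : m ≤ i) (hi' : i ≤ 2 * n - m) : (cis n i).re ≤ (cis n m).re := by
    have hle := cis_re_le_of_abs_le hn (k := i - n) (m := n - m) (by rw [abs_le]; omega) (by omega)
    rw [cis_self_sub_re hn, ← neg_sub, cis_neg_re, cis_self_sub_re hn] at hle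
    linarith
  refine (convex_halfSpace_le (proj n (2 * k + m)).isLinear _).openSegment_subset ?_ ?_ hz
  · rw [Set.mem_ofPred_eq, proj_cis]
    exact hend (by linarith) (by linarith)
  · rw [Set.mem_ofPred_eq, proj_cis]
    exact hend (by linarith) (by linarith)

/- The smaller of the two caps cut off by a chord stays in the polygon when it is rotated by a half
turn about the midpoint of the chord. So the direction of an edge of this cap is free at both ends
of a segment that has one end on the edge and the same midpoint as the chord. -/
lemma IsRigid.notMem_openEdge (hn : 3 ≤ n) {x : Fin 4 → ℂ} (h : IsRigid n x)
    (hx : ∀ i, x i ∈ regularPolygon n) {p q : Fin 4} (hpq : p ≠ q) {k j m : ℤ} (hj : 0 ≤ j)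
    (hjm : j < m) (hm : 2 * m ≤ n) (hsum : x p + x q = cis n (2 * k) + cis n (2 * (k + m))) :
    x p ∉ openEdge n (k + j) := by
  intro hp
  have hv := polygonVertices_subset (n := n) (by omega)
  have hfree := freeDir_of_mem_openSegment (convex_regularPolygon n)
    (hv (cis_two_mul_mem_polygonVertices _)) (hv (cis_two_mul_add_two_mem_polygonVertices _)) hp
  have hq : x q ∈ openSegment ℝ
      (cis n (2 * k) + cis n (2 * (k + m)) - cis n (2 * (k + j)))
      (cis n (2 * k) + cis n (2 * (k + m)) - cis n (2 * (k + (j + 1)))) := by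
    obtain ⟨a, b, ha, hb, hab, hp⟩ := hp
    refine ⟨a, b, ha, hb, hab, ?_⟩
    rw [← hsum, ← add_sub_cancel_left (x p) (x q), smul_sub, smul_sub, add_sub_cancel_left,
      sub_add_sub_comm, ← add_smul, hab, one_smul, show 2 * (k + (j + 1)) = 2 * (k + j) + 2 by ring,
      hp, add_sub_cancel_left]
  have hfree' := freeDir_of_mem_openSegment (convex_regularPolygon n)
    (cis_add_cis_sub_cis_mem hn k hj hjm.le hm)
    (cis_add_cis_sub_cis_mem hn k (by omega) (by omega) hm) hq
  rw [sub_sub_sub_cancel_left, show 2 * (k + (j + 1)) = 2 * (k + j) + 2 by ring] at hfree'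
  have hzero := h.eq_zero_of_two hx hpq hfree (by simpa using hfree'.smul (-1))
  exact cis_two_mul_ne hn (k + j) (sub_eq_zero.mp hzero).symm

lemma IsRigid.proj_le_of_add_eq (hn : 3 ≤ n) {x : Fin 4 → ℂ} (h : IsRigid n x)
    (hx : ∀ i, x i ∈ regularPolygon n) {p q : Fin 4} (hpq : p ≠ q) {k m t : ℤ} (hm0 : 0 ≤ m)
    (hm : 2 * m ≤ n) (hsum : x p + x q = cis n (2 * k) + cis n (2 * (k + m)))
    (hp : x p ∈ openEdge n t) : proj n (2 * k + m) (x p) ≤ (cis n m).re := by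
  obtain ⟨j, hj0, hjn, hj⟩ := exists_mem_openEdge_add (by omega) k hp
  rcases lt_or_ge j m with hjm | hmj
  · exact (h.notMem_openEdge hn hx hpq hj0 hjm hm hsum hj).elim
  · exact proj_le_of_mem_openEdge hm0 hmj hjn hj

lemma exists_chord (hn : n ≠ 0) {a c : ℂ} (ha : a ∈ polygonVertices n)
    (hc : c ∈ polygonVertices n) : ∃ k m : ℤ, 0 ≤ m ∧ 2 * m ≤ n ∧
      a + c = cis n (2 * k) + cis n (2 * (k + m)) ∧ proj n (2 * k + m) a = (cis n m).re := by
  obtain ⟨k, rfl⟩ := ha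
  obtain ⟨l, rfl⟩ := hc
  obtain ⟨m, hm0, hmn, hl⟩ := exists_cis_two_mul_eq hn k l
  dsimp only
  rcases le_or_gt (2 * m) n with hm | hm
  · refine ⟨k, m, hm0, hm, by rw [hl], ?_⟩
    rw [proj_cis, ← cis_neg_re]
    ring_nf
  · have hk : cis n (2 * k) = cis n (2 * (k + m + (n - m))) := by
      rw [cis_eq_iff hn]
      exact ⟨-1, by ring⟩
    refine ⟨k + m, n - m, by omega, by omega, by rw [hl, add_comm, hk], ?_⟩
    rw [hk, proj_cis]
    ring_nf

lemma IsRigid.planeDet_eq_zero (hn : 3 ≤ n) {x : Fin 4 → ℂ} (h : IsRigid n x)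
    (hx : ∀ i, x i ∈ regularPolygon n) {p q : Fin 4} (hpq : p ≠ q)
    (hp : x p ∉ polygonVertices n) (hq : x q ∉ polygonVertices n) {a c : ℂ}
    (ha : a ∈ polygonVertices n) (hc : c ∈ polygonVertices n) (hsum : x p + x q = a + c) :
    planeDet (x p - a) (x q - a) = 0 := by
  obtain ⟨s, t, hs, ht, -⟩ := h.exists_openEdges hn hx hpq hp hq
  obtain ⟨k, m, hm0, hm, hac, hproj⟩ := exists_chord (by omega) ha hc
  have hsum' := hsum.trans hac
  have hple := h.proj_le_of_add_eq hn hx hpq hm0 hm hsum' hs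
  have hqle := h.proj_le_of_add_eq hn hx hpq.symm hm0 hm ((add_comm _ _).trans hsum') ht
  have hadd : proj n (2 * k + m) (x p) + proj n (2 * k + m) (x q) = 2 * (cis n m).re := by
    rw [← map_add, hsum', map_add, proj_cis, proj_cis, show 2 * k - (2 * k + m) = -m by ring,
      show 2 * (k + m) - (2 * k + m) = m by ring, cis_neg_re, two_mul]
  rw [planeDet_eq_proj_perp (n := n) (2 * k + m), map_sub (proj n (2 * k + m)) (x p),
    map_sub (proj n (2 * k + m)) (x q), hproj,
    show proj n (2 * k + m) (x p) = (cis n m).re by linarith,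
    show proj n (2 * k + m) (x q) = (cis n m).re by linarith]
  ring

end opposite

section adjacent

variable {n : ℕ}

lemma mem_of_abs_perp_le (hn : 3 ≤ n) (s : ℤ) {z w : ℂ} (hw : w ∈ regularPolygon n)
    (hproj : proj n s z = proj n s w) (hperp : |perp n s z| ≤ |perp n s w|) :
    z ∈ regularPolygon n := by
  refine (mem_regularPolygon_iff hn z).mpr fun t => ?_
  have h := proj_odd_le (by omega) t hw
  have hrefl := proj_odd_le (by omega) (s - t - 1) hw
  rw [proj_eq_proj_perp s] at h
  rw [proj_eq_proj_perp s, show 2 * (s - t - 1) + 1 - s = -(2 * t + 1 - s) by ring, cis_neg_re,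
    cis_neg_im] at hrefl
  have hmul : perp n s z * (cis n (2 * t + 1 - s)).im ≤
      |perp n s w * (cis n (2 * t + 1 - s)).im| := by
    refine (le_abs_self _).trans ?_
    rw [abs_mul, abs_mul]
    gcongr
  rw [proj_eq_proj_perp s, hproj]
  rcases abs_cases (perp n s w * (cis n (2 * t + 1 - s)).im) with ⟨habs, -⟩ | ⟨habs, -⟩ <;> linarith

lemma proj_I_mul_cis (s : ℤ) : proj n s (I * cis n s) = 0 := by
  rw [proj_apply, I_mul_re, I_mul_im]
  ring

lemma perp_I_mul_cis (s : ℤ) : perp n s (I * cis n s) = 1 := by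
  rw [perp_apply, I_mul_re, I_mul_im, ← cis_sq_add_sq (n := n) s]
  ring

lemma freeDir_of_abs_perp_lt (hn : 3 ≤ n) (s : ℤ) {z w : ℂ} (hw : w ∈ regularPolygon n)
    (hproj : proj n s z = proj n s w) (hperp : |perp n s z| < |perp n s w|) :
    FreeDir (regularPolygon n) z (I * cis n s) := by
  have hcont : Continuous fun δ : ℝ => |perp n s z + δ| := by fun_prop
  filter_upwards [(hcont.tendsto' 0 _ (by rw [add_zero])).eventually_lt_const hperp] with δ hδ
  apply mem_of_abs_perp_le hn s hw
  · rw [map_add, map_smul, proj_I_mul_cis, smul_zero, add_zero, hproj]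
  · rw [map_add, map_smul, perp_I_mul_cis, smul_eq_mul, mul_one]
    exact hδ.le

lemma abs_perp_le_of_mem_openEdge (hn : 3 ≤ n) {s t u : ℤ} {z w : ℂ} (hz : z ∈ openEdge n t)
    (hw : w ∈ openEdge n u) (htu : ¬ (n : ℤ) ∣ u - t) (hproj : proj n s z = proj n s w) :
    |perp n s w| ≤ |perp n s z| := by
  by_contra! hperp
  have hfree := freeDir_of_abs_perp_lt hn s (openEdge_subset (by omega) u hw) hproj hperp
  have hw_eq : w = z + (perp n s w - perp n s z) • (I * cis n s) := by
    apply ext_proj_perp (n := n) s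
    · rw [map_add, map_smul, proj_I_mul_cis, smul_zero, add_zero, hproj]
    · rw [map_add, map_smul, perp_I_mul_cis, smul_eq_mul, mul_one, add_sub_cancel]
  apply htu
  apply dvd_sub_of_proj_eq hn hw
  rw [hw_eq, map_add, map_smul, hfree.proj_eq_zero_of_mem_openEdge (by omega) hz, smul_zero,
    add_zero, proj_eq_of_mem_openEdge hz]

lemma cis_two_mul_add_cis_two_mul (p q : ℤ) :
    cis n (2 * p) + cis n (2 * q) = (2 * (cis n (p - q)).re) • cis n (p + q) := by
  rw [← cis_add_add_cis_sub]
  ring_nf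

/- The side from `c` to `d` is orthogonal to the axis of symmetry `cis n (p + q)` of the side from
`cis n (2 * p)` to `cis n (2 * q)`. If `c` and `d` were not mirror images in this axis, then the one
closer to it could move freely orthogonally to it. -/
lemma exists_eq_sub_smul (hn : 3 ≤ n) {p q s t : ℤ} {c d : ℂ} (hc : c ∈ openEdge n s)
    (hd : d ∈ openEdge n t) (hst : ¬ (n : ℤ) ∣ s - t) (hpq : ¬ (n : ℤ) ∣ p - q)
    (hsum : cis n (2 * p) + c = cis n (2 * q) + d) : ∃ μ : ℝ, 0 < μ ∧ μ < 1 ∧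
      c = cis n (2 * q) - μ • (cis n (2 * p) + cis n (2 * q)) ∧
      d = cis n (2 * p) - μ • (cis n (2 * p) + cis n (2 * q)) := by
  have hp : 2 * p - (p + q) = p - q := by ring
  have hq : 2 * q - (p + q) = -(p - q) := by ring
  have hproj := congrArg (proj n (p + q)) hsum
  have hperp := congrArg (perp n (p + q)) hsum
  simp only [map_add, proj_cis, perp_cis, hp, hq, cis_neg_re, cis_neg_im] at hproj hperp
  have hproj : proj n (p + q) c = proj n (p + q) d := by linarith
  have hsin : (cis n (p - q)).im ≠ 0 := by rwa [Ne, cis_im_eq_zero_iff (by omega)]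
  have habs : |perp n (p + q) c| = |perp n (p + q) d| := le_antisymm
    (abs_perp_le_of_mem_openEdge hn hd hc hst hproj.symm)
    (abs_perp_le_of_mem_openEdge hn hc hd (by rwa [dvd_sub_comm]) hproj)
  have hmirror : perp n (p + q) c = -perp n (p + q) d :=
    (abs_eq_abs.mp habs).resolve_left fun h => hsin (by linarith)
  have hlt : |proj n (p + q) d| < |(cis n (p - q)).re| := by
    have hpyth := proj_sq_add_perp_sq (n := n) (p + q) d
    have hnorm := (sq_lt_one_iff₀ (norm_nonneg d)).mpr (norm_lt_one_of_mem_openEdge hn hd)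
    rw [show perp n (p + q) d = (cis n (p - q)).im by linarith] at hpyth
    exact sq_lt_sq.mp (by linarith [cis_sq_add_sq (n := n) (p - q)])
  have hcos : (cis n (p - q)).re ≠ 0 := abs_pos.mp ((abs_nonneg _).trans_lt hlt)
  have hratio := abs_lt.mp (show |proj n (p + q) d / (cis n (p - q)).re| < 1 by
    rwa [abs_div, div_lt_one (abs_pos.mpr hcos)])
  refine ⟨(1 - proj n (p + q) d / (cis n (p - q)).re) / 2, by linarith, by linarith, ?_, ?_⟩ <;>
    apply ext_proj_perp (n := n) (p + q) <;>
    simp only [cis_two_mul_add_cis_two_mul, map_sub, map_smul, proj_cis, perp_cis, hp, hq, sub_self,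
      cis_zero, cis_neg_re, cis_neg_im, one_re, one_im, smul_eq_mul, mul_zero, sub_zero] <;>
    first | (field_simp; linarith) | linarith

lemma IsRigid.le_of_sub_smul_mem {x : Fin 4 → ℂ} (h : IsRigid n x)
    (hx : ∀ i, x i ∈ regularPolygon n) {a b v : ℂ} {μ ν : ℝ} (hv : v ≠ 0) (hμ : 0 < μ)
    (ha : a ∈ regularPolygon n) (hb : b ∈ regularPolygon n) (hx2 : x 2 = b - μ • v)
    (hx3 : x 3 = a - μ • v) (haν : a - ν • v ∈ regularPolygon n)
    (hbν : b - ν • v ∈ regularPolygon n) : ν ≤ μ := by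
  by_contra! hμν
  have hν : 0 < ν := hμ.trans hμν
  have hfree {e : ℂ} (he : e ∈ regularPolygon n) (heν : e - ν • v ∈ regularPolygon n) :
      FreeDir (regularPolygon n) (e - μ • v) (ν • v) := by
    have hseg : e - μ • v ∈ openSegment ℝ (e - ν • v) e := by
      refine ⟨μ / ν, 1 - μ / ν, by positivity, sub_pos.mpr ((div_lt_one hν).mpr hμν), by ring, ?_⟩
      rw [smul_sub, smul_smul, div_mul_cancel₀ _ hν.ne']
      module
    simpa using freeDir_of_mem_openSegment (convex_regularPolygon n) heν he hseg
  have hzero := h.eq_zero_of_two hx (p := 2) (q := 3) (by decide) (hx2 ▸ hfree hb hbν)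
    (hx3 ▸ hfree ha haν)
  exact smul_ne_zero hν.ne' hv hzero

end adjacent

/-- The rigid parallelograms whose corners with index in `S`, and only these, are vertices of the
polygon. -/
def patternTuples (n : ℕ) (S : Finset (Fin 4)) : Set (Fin 4 → ℂ) :=
  {x ∈ vertexTuples n | ∀ i, x i ∈ polygonVertices n ↔ i ∈ S}

/-- The cyclic relabelling of the corners of a quadrilateral that starts with corner `k`. -/
def tupleShift (k : Fin 4) (x : Fin 4 → ℂ) : Fin 4 → ℂ := fun i => x (i + k)

section patterns

variable {n : ℕ}

lemma tupleShift_injective (k : Fin 4) : Function.Injective (tupleShift k) := fun x y h =>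
  funext fun i => by simpa [tupleShift] using congrFun h (i - k)

lemma tupleShift_add (k l : Fin 4) (x : Fin 4 → ℂ) :
    tupleShift (k + l) x = tupleShift k (tupleShift l x) :=
  funext fun i => congrArg x (add_assoc i k l).symm

lemma IsRigid.tupleShift {x : Fin 4 → ℂ} (h : IsRigid n x) (k : Fin 4) :
    IsRigid n (tupleShift k x) := by
  intro w hw hsum
  have hzero := h (fun i => w (i - k)) (fun i => by simpa [_root_.tupleShift] using hw (i - k))
    (((Equiv.subRight k).sum_comp w).trans hsum)
  funext i
  simpa using congrFun hzero (i + k)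

lemma tupleShift_one_mem_vertexTuples {x : Fin 4 → ℂ} (hx : x ∈ vertexTuples n) :
    tupleShift 1 x ∈ vertexTuples n := by
  obtain ⟨hmem, hsum, hrigid, hdet⟩ := hx
  refine ⟨fun i => hmem _, ?_, hrigid.tupleShift 1, ?_⟩
  · change x 1 + x 3 = x 2 + x 0
    rw [← hsum, add_comm]
  · change planeDet (x 1 - x 2) (x 3 - x 2) ≠ 0
    convert hdet using 1
    rw [show x 3 = x 0 + x 2 - x 1 by rw [hsum, add_sub_cancel_left]]
    simp only [planeDet, sub_re, sub_im, add_re, add_im]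
    ring

lemma tupleShift_mem_vertexTuples {x : Fin 4 → ℂ} (hx : x ∈ vertexTuples n) (k : Fin 4) :
    tupleShift k x ∈ vertexTuples n := by
  induction k using Fin.induction with
  | zero =>
    change (fun i => x (i + 0)) ∈ vertexTuples n
    simpa using hx
  | succ k ih =>
    rw [← Fin.coeSucc_eq_succ, add_comm, tupleShift_add]
    exact tupleShift_one_mem_vertexTuples ih

lemma encard_patternTuples_eq {S T : Finset (Fin 4)} (k : Fin 4) (h : ∀ i, i ∈ S ↔ i + k ∈ T) :
    (patternTuples n S).encard = (patternTuples n T).encard := by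
  rw [← (tupleShift_injective k).encard_image (patternTuples n T)]
  congr 1
  apply subset_antisymm
  · rintro x ⟨hx, hS⟩
    refine ⟨tupleShift (-k) x, ⟨tupleShift_mem_vertexTuples hx _, fun i => ?_⟩, ?_⟩
    · rw [tupleShift, hS, h, neg_add_cancel_right]
    · funext i
      simp [tupleShift]
  · rintro _ ⟨x, ⟨hx, hT⟩, rfl⟩
    exact ⟨tupleShift_mem_vertexTuples hx k, fun i => (hT _).trans (h i).symm⟩

lemma mem_polygonVertices_or_of_mem_vertexTuples (hn : 3 ≤ n) {x : Fin 4 → ℂ}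
    (hx : x ∈ vertexTuples n) (p : Fin 4) :
    x p ∈ polygonVertices n ∨ x (p + 2) ∈ polygonVertices n := by
  suffices h : ∀ y ∈ vertexTuples n, y 0 ∈ polygonVertices n ∨ y 2 ∈ polygonVertices n by
    simpa [tupleShift, add_comm] using h _ (tupleShift_mem_vertexTuples hx p)
  rintro y ⟨hmem, hsum, hrigid, hdet⟩
  by_contra! hy
  have hy1 := hrigid.mem_polygonVertices hn hmem (r := 1) (by decide) (by decide) (by decide)
    hy.1 hy.2
  have hy3 := hrigid.mem_polygonVertices hn hmem (r := 3) (by decide) (by decide) (by decide)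
    hy.1 hy.2
  exact hdet (hrigid.planeDet_eq_zero hn hmem (by decide) hy.1 hy.2 hy1 hy3 hsum)

/-- The possible sets of corners of a nondegenerate rigid parallelogram that are vertices of the
polygon: all corners, all but one, or two adjacent ones. -/
def vertexPattern : Unit ⊕ Fin 4 ⊕ Fin 4 → Finset (Fin 4) :=
  Sum.elim (fun _ => Finset.univ) (Sum.elim (fun k => {k}ᶜ) fun k => {k, k + 1})

lemma vertexPattern_injective : Function.Injective vertexPattern := by decide

lemma exists_vertexPattern_eq : ∀ S : Finset (Fin 4), (∀ i, i ∈ S ∨ i + 2 ∈ S) →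
    Sᶜ.card ≤ 2 → ∃ i, vertexPattern i = S := by
  decide

lemma vertexTuples_eq_iUnion (hn : 3 ≤ n) :
    vertexTuples n = ⋃ i, patternTuples n (vertexPattern i) := by
  classical
  apply subset_antisymm
  · intro x hx
    let S : Finset (Fin 4) := {i | x i ∈ polygonVertices n}
    have hS i : x i ∈ polygonVertices n ↔ i ∈ S := by simp [S]
    have hopp i : i ∈ S ∨ i + 2 ∈ S := by
      simpa only [hS] using mem_polygonVertices_or_of_mem_vertexTuples hn hx i
    have htwo : Sᶜ.card ≤ 2 := by
      by_contra! hcard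
      obtain ⟨p, q, r, hp, hq, hr, hpq, hpr, hqr⟩ := Finset.two_lt_card_iff.mp hcard
      simp only [Finset.mem_compl, ← hS] at hp hq hr
      exact hr (hx.2.2.1.mem_polygonVertices hn hx.1 hpq hpr hqr hp hq)
    obtain ⟨i, hi⟩ := exists_vertexPattern_eq S hopp htwo
    exact Set.mem_iUnion.mpr ⟨i, hx, hi ▸ hS⟩
  · exact Set.iUnion_subset fun i _ hx => hx.1

lemma encard_vertexTuples (hn : 3 ≤ n) : (vertexTuples n).encard =
    (patternTuples n Finset.univ).encard + 4 * (patternTuples n {0, 1, 2}).encard +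
      4 * (patternTuples n {0, 1}).encard := by
  have hdisj : Pairwise (Function.onFun Disjoint fun i => patternTuples n (vertexPattern i)) := by
    intro i j hij
    refine Set.disjoint_left.mpr fun x hi hj => hij (vertexPattern_injective ?_)
    exact Finset.ext fun l => (hi.2 l).symm.trans (hj.2 l)
  have hthree (k : Fin 4) : (patternTuples n {k}ᶜ).encard = (patternTuples n {0, 1, 2}).encard :=
    encard_patternTuples_eq (3 - k) (by decide +revert)
  have htwo (k : Fin 4) : (patternTuples n {k, k + 1}).encard = (patternTuples n {0, 1}).encard :=
    encard_patternTuples_eq (-k) (by decide +revert)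
  rw [vertexTuples_eq_iUnion hn, Set.encard_iUnion_of_finite hdisj, finsum_eq_sum_of_fintype]
  simp only [Fintype.sum_sum_type, vertexPattern, Sum.elim_inl, Sum.elim_inr, hthree, htwo,
    Finset.sum_const, Finset.card_univ, Fintype.card_unit, Fintype.card_fin, one_smul,
    nsmul_eq_mul, Nat.cast_ofNat, add_assoc]

end patterns

section pair

variable {n : ℕ}

lemma exists_mem_Ico_eq_cis (hn : n ≠ 0) {z : ℂ} (hz : z ∈ polygonVertices n) :
    ∃ k ∈ Set.Ico 0 (n : ℤ), z = cis n (2 * k) := by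
  obtain ⟨l, rfl⟩ := hz
  obtain ⟨k, hk0, hkn, hk⟩ := exists_cis_two_mul_eq hn 0 l
  exact ⟨k, ⟨hk0, hkn⟩, by rwa [zero_add] at hk⟩

lemma exists_sub_mem_Ioo_eq_cis (hn : n ≠ 0) (q : ℤ) {z : ℂ} (hz : z ∈ polygonVertices n)
    (hne : z ≠ cis n (2 * q)) : ∃ p, p - q ∈ Set.Ioo 0 (n : ℤ) ∧ z = cis n (2 * p) := by
  obtain ⟨l, rfl⟩ := hz
  obtain ⟨r, hr0, hrn, hr⟩ := exists_cis_two_mul_eq hn q l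
  refine ⟨q + r, ?_, hr⟩
  rw [add_sub_cancel_left]
  refine ⟨hr0.lt_of_ne' ?_, hrn⟩
  rintro rfl
  exact hne (by rwa [add_zero] at hr)

lemma not_dvd_of_mem_Ioo {r : ℤ} (hr : r ∈ Set.Ioo 0 (n : ℤ)) : ¬ (n : ℤ) ∣ r := fun h =>
  (Int.le_of_dvd hr.1 h).not_gt hr.2

lemma ne_of_mem_vertexTuples {x : Fin 4 → ℂ} (hx : x ∈ vertexTuples n) : x 0 ≠ x 1 ∧ x 2 ≠ x 1 := by
  refine ⟨fun h => hx.2.2.2 ?_, fun h => hx.2.2.2 ?_⟩ <;>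
    simp only [h, planeDet, sub_self, zero_re, zero_im, zero_mul, mul_zero]

lemma exists_eq_of_mem_patternTuples_pair (hn : 3 ≤ n) {x : Fin 4 → ℂ}
    (hx : x ∈ patternTuples n {0, 1}) : ∃ (p q : ℤ) (μ : ℝ), q ∈ Set.Ico 0 (n : ℤ) ∧
      p - q ∈ Set.Ioo 0 (n : ℤ) ∧
      cis n (2 * p) + cis n (2 * q) ≠ 0 ∧ 0 < μ ∧ μ < 1 ∧
      x = ![cis n (2 * p), cis n (2 * q), cis n (2 * q) - μ • (cis n (2 * p) + cis n (2 * q)),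
        cis n (2 * p) - μ • (cis n (2 * p) + cis n (2 * q))] := by
  have hne := (ne_of_mem_vertexTuples hx.1).1
  obtain ⟨⟨hmem, hsum, hrigid, -⟩, hpattern⟩ := hx
  obtain ⟨q, hq0, hq⟩ := exists_mem_Ico_eq_cis (by omega) ((hpattern 1).mpr (by decide))
  obtain ⟨p, hpq, hp⟩ := exists_sub_mem_Ioo_eq_cis (by omega) q ((hpattern 0).mpr (by decide))
    (hq ▸ hne)
  have hx2 : x 2 ∉ polygonVertices n := (hpattern 2).not.mpr (by decide)
  have hx3 : x 3 ∉ polygonVertices n := (hpattern 3).not.mpr (by decide)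
  obtain ⟨s, t, hs, ht, hst⟩ := hrigid.exists_openEdges hn hmem (by decide) hx2 hx3
  obtain ⟨μ, hμ0, hμ1, h2, h3⟩ := exists_eq_sub_smul hn hs ht
    (fun h => hst (h.mul_left 2)) (not_dvd_of_mem_Ioo hpq) (by rwa [← hp, ← hq])
  refine ⟨p, q, μ, hq0, hpq, fun hzero => hx3 ?_, hμ0, hμ1, ?_⟩
  · rw [h3, hzero, smul_zero, sub_zero]
    exact cis_two_mul_mem_polygonVertices p
  · funext i
    fin_cases i
    exacts [hp, hq, h2, h3]

lemma patternTuples_pair_eq_empty (hn : 3 ≤ n) (heven : Even n) :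
    patternTuples n {0, 1} = ∅ := by
  refine Set.eq_empty_of_forall_notMem fun x hx => ?_
  obtain ⟨p, q, μ, -, -, hv, hμ0, hμ1, rfl⟩ := exists_eq_of_mem_patternTuples_pair hn hx
  have hantipode (k : ℤ) : -cis n (2 * k) ∈ regularPolygon n := by
    obtain ⟨l, rfl⟩ := heven
    rw [← cis_add_self (by omega), show 2 * k + ((l + l : ℕ) : ℤ) = 2 * (k + l) by push_cast; ring]
    exact polygonVertices_subset (by omega) (cis_two_mul_mem_polygonVertices _)
  have hvertex (k : ℤ) : cis n (2 * k) ∈ regularPolygon n :=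
    polygonVertices_subset (by omega) (cis_two_mul_mem_polygonVertices k)
  have hle : 1 ≤ μ := hx.1.2.2.1.le_of_sub_smul_mem hx.1.1 hv hμ0 (hvertex p) (hvertex q) rfl rfl
    (by rw [one_smul, sub_add_cancel_left]; exact hantipode q)
    (by rw [one_smul, sub_add_cancel_right]; exact hantipode p)
  exact hle.not_gt hμ1

/-- For odd `n` and `k = p - q`, the number `μ` for which the point
`cis n (2 * p) - μ • (cis n (2 * p) + cis n (2 * q))` of the chord from the vertex `p` to the
antipode of the vertex `q` lies on the line through the side opposite to the vertex `q`. -/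
def chordRatio (n : ℕ) (k : ℤ) : ℝ :=
  ((cis n 1).re + (cis n (2 * k)).re) / (1 + (cis n (2 * k)).re)

/-- For odd `n`, the point where the chord from the vertex `p` to the antipode of the vertex `q`
leaves the polygon. -/
def chordEnd (n : ℕ) (p q : ℤ) : ℂ :=
  cis n (2 * p) - chordRatio n (p - q) • (cis n (2 * p) + cis n (2 * q))

/-- For odd `n`, the parallelogram whose first two corners are the vertices `p` and `q`, and whose
other two sides extend along the chords to their antipodes as far as the polygon allows. -/
def adjacentTuple (n : ℕ) (p q : ℤ) : Fin 4 → ℂ :=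
  ![cis n (2 * p), cis n (2 * q), chordEnd n q p, chordEnd n p q]

lemma chordRatio_neg (k : ℤ) : chordRatio n (-k) = chordRatio n k := by
  rw [chordRatio, chordRatio, mul_neg, cis_neg_re]

lemma adjacentTuple_eq (p q : ℤ) : adjacentTuple n p q =
    ![cis n (2 * p), cis n (2 * q),
      cis n (2 * q) - chordRatio n (p - q) • (cis n (2 * p) + cis n (2 * q)),
      cis n (2 * p) - chordRatio n (p - q) • (cis n (2 * p) + cis n (2 * q))] := by
  rw [adjacentTuple, chordEnd, chordEnd, ← neg_sub p q, chordRatio_neg,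
    add_comm (cis n (2 * q))]

lemma planeDet_adjacentTuple (p q : ℤ) :
    planeDet (adjacentTuple n p q 0 - adjacentTuple n p q 1)
        (adjacentTuple n p q 2 - adjacentTuple n p q 1) =
      2 * chordRatio n (p - q) * (cis n (2 * (p - q))).im := by
  rw [adjacentTuple_eq, show 2 * (p - q) = 2 * p + -(2 * q) by ring, cis_add_im, cis_neg_re,
    cis_neg_im]
  simp only [planeDet, Matrix.cons_val, sub_re, sub_im, smul_re, smul_im, add_re, add_im,
    smul_eq_mul]
  ring

variable {m : ℤ}

lemma cis_two_mul_add_odd_re (hm : (n : ℤ) = 2 * m + 1) (k : ℤ) :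
    (cis n (2 * (k + m) + 1)).re = -(cis n (2 * k)).re := by
  rw [show 2 * (k + m) + 1 = 2 * k + n by rw [hm]; ring, cis_add_self (by omega), neg_re]

lemma cis_one_re_lt_one (hn : n ≠ 0) : (cis n 1).re < 1 := by
  refine lt_of_le_of_ne ?_ fun h => ?_
  · exact (re_le_norm _).trans_eq (norm_cis 1)
  · have := Int.le_of_dvd one_pos ((cis_re_eq_one_iff hn 1).mp h)
    omega

lemma one_add_cis_re_pos (hm : (n : ℤ) = 2 * m + 1) (k : ℤ) : 0 < 1 + (cis n (2 * k)).re := by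
  have hle := cis_odd_re_le (n := n) (by omega) (k + m)
  rw [cis_two_mul_add_odd_re hm] at hle
  linarith [cis_one_re_lt_one (n := n) (by omega)]

lemma cis_two_mul_add_ne_zero (hm : (n : ℤ) = 2 * m + 1) (p q : ℤ) :
    cis n (2 * p) + cis n (2 * q) ≠ 0 := fun h => by
  have hproj := congrArg (proj n (2 * q)) h
  rw [map_add, proj_cis, proj_cis, sub_self, cis_zero, one_re, map_zero, ← mul_sub] at hproj
  linarith [one_add_cis_re_pos hm (p - q)]

lemma chordRatio_lt_one (hm : (n : ℤ) = 2 * m + 1) (k : ℤ) : chordRatio n k < 1 := by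
  rw [chordRatio, div_lt_one (one_add_cis_re_pos hm k)]
  gcongr
  exact cis_one_re_lt_one (by omega)

lemma chordRatio_pos_iff (hm : (n : ℤ) = 2 * m + 1) (k : ℤ) :
    0 < chordRatio n k ↔ ¬ ((n : ℤ) ∣ k + m ∨ (n : ℤ) ∣ k + m + 1) := by
  rw [chordRatio, div_pos_iff_of_pos_right (one_add_cis_re_pos hm k), ← sub_neg_eq_add, sub_pos,
    ← cis_two_mul_add_odd_re hm, (cis_odd_re_le (by omega) (k + m)).lt_iff_ne, Ne,
    cis_odd_re_eq_iff (by omega)]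

lemma proj_sub_smul (hm : (n : ℤ) = 2 * m + 1) (p q : ℤ) (μ : ℝ) :
    proj n (2 * (q + m) + 1) (cis n (2 * p) - μ • (cis n (2 * p) + cis n (2 * q))) =
      μ * (1 + (cis n (2 * (p - q))).re) - (cis n (2 * (p - q))).re := by
  rw [show 2 * (q + m) + 1 = 2 * q + n by rw [hm]; ring, proj_add_self (by omega)]
  simp only [map_sub, map_smul, map_add, proj_cis, sub_self, cis_zero, one_re, smul_eq_mul, mul_sub]
  ring

lemma chordEnd_mem_openEdge (hn : 3 ≤ n) (hm : (n : ℤ) = 2 * m + 1) {p q : ℤ}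
    (hpos : 0 < chordRatio n (p - q)) : chordEnd n p q ∈ openEdge n (q + m) := by
  apply mem_openEdge_of_norm_lt_one hn
  · rw [chordEnd, proj_sub_smul hm, chordRatio, div_mul_cancel₀ _ (one_add_cis_re_pos hm _).ne',
      add_sub_cancel_right]
  · have hne : cis n (2 * p) ≠ -cis n (2 * q) := fun h =>
      cis_two_mul_add_ne_zero hm p q (eq_neg_iff_add_eq_zero.mp h)
    have hlt := norm_combo_lt_of_ne (norm_cis _).le ((norm_neg _).trans (norm_cis _)).le hne
      (sub_pos.mpr (chordRatio_lt_one hm (p - q))) hpos (sub_add_cancel _ _)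
    rwa [show chordEnd n p q = (1 - chordRatio n (p - q)) • cis n (2 * p) +
      chordRatio n (p - q) • -cis n (2 * q) by unfold chordEnd; module]

lemma le_chordRatio (hn : 3 ≤ n) (hm : (n : ℤ) = 2 * m + 1) {p q : ℤ} {μ : ℝ}
    (h : cis n (2 * p) - μ • (cis n (2 * p) + cis n (2 * q)) ∈ regularPolygon n) :
    μ ≤ chordRatio n (p - q) := by
  have hle := proj_odd_le (by omega) (q + m) h
  rw [proj_sub_smul hm] at hle
  rw [chordRatio, le_div_iff₀ (one_add_cis_re_pos hm _)]
  linarith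

lemma exists_adjacentTuple_eq (hn : 3 ≤ n) (hm : (n : ℤ) = 2 * m + 1) {x : Fin 4 → ℂ}
    (hx : x ∈ patternTuples n {0, 1}) :
    ∃ p q : ℤ, q ∈ Set.Ico 0 (n : ℤ) ∧ p - q ∈ Set.Ioo 0 (n : ℤ) ∧
      0 < chordRatio n (p - q) ∧ x = adjacentTuple n p q := by
  obtain ⟨p, q, μ, hq, hpq, hv, hμ, -, rfl⟩ := exists_eq_of_mem_patternTuples_pair hn hx
  have hle : μ ≤ chordRatio n (p - q) := le_chordRatio hn hm (hx.1.1 3)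
  have hpos := hμ.trans_le hle
  have hend {k l : ℤ} (h : 0 < chordRatio n (k - l)) : chordEnd n k l ∈ regularPolygon n :=
    openEdge_subset (by omega) _ (chordEnd_mem_openEdge hn hm h)
  have hvertex (k : ℤ) : cis n (2 * k) ∈ regularPolygon n :=
    polygonVertices_subset (by omega) (cis_two_mul_mem_polygonVertices k)
  have hge : chordRatio n (p - q) ≤ μ :=
    hx.1.2.2.1.le_of_sub_smul_mem hx.1.1 hv hμ (hvertex p) (hvertex q) rfl rfl (hend hpos) (by
      have := hend (k := q) (l := p) (by rwa [← neg_sub, chordRatio_neg])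
      rwa [chordEnd, ← neg_sub p q, chordRatio_neg, add_comm (cis n (2 * q))] at this)
  exact ⟨p, q, hq, hpq, hpos, by rw [adjacentTuple_eq, hle.antisymm hge]⟩

lemma adjacentTuple_mem_patternTuples (hn : 3 ≤ n) (hm : (n : ℤ) = 2 * m + 1) {p q : ℤ}
    (hpq : ¬ (n : ℤ) ∣ p - q) (hpos : 0 < chordRatio n (p - q)) :
    adjacentTuple n p q ∈ patternTuples n {0, 1} := by
  have hdvd {k : ℤ} : (n : ℤ) ∣ 2 * k → (n : ℤ) ∣ k :=
    IsCoprime.dvd_of_dvd_mul_left ⟨1, -m, by rw [hm]; ring⟩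
  have h0 : adjacentTuple n p q 0 ∈ polygonVertices n := cis_two_mul_mem_polygonVertices p
  have h1 : adjacentTuple n p q 1 ∈ polygonVertices n := cis_two_mul_mem_polygonVertices q
  have h2 : adjacentTuple n p q 2 ∈ openEdge n (p + m) :=
    chordEnd_mem_openEdge hn hm (by rwa [← neg_sub, chordRatio_neg])
  have h3 : adjacentTuple n p q 3 ∈ openEdge n (q + m) := chordEnd_mem_openEdge hn hm hpos
  refine ⟨⟨fun i => ?_, ?_, ?_, ?_⟩, fun i => ?_⟩
  · fin_cases i
    exacts [polygonVertices_subset (by omega) h0, polygonVertices_subset (by omega) h1,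
      openEdge_subset (by omega) _ h2, openEdge_subset (by omega) _ h3]
  · rw [adjacentTuple_eq]
    simp only [Matrix.cons_val]
    ring
  · refine isRigid_of_two_vertices (by omega) h0 h1 h2 h3 fun h => hpq ?_
    rw [add_sub_add_right_eq_sub] at h
    exact hdvd h
  · rw [planeDet_adjacentTuple]
    refine mul_ne_zero (mul_ne_zero two_ne_zero hpos.ne') fun h => hpq ?_
    exact hdvd ((cis_im_eq_zero_iff (by omega) _).mp h)
  · have h2 := notMem_polygonVertices_of_mem_openEdge hn h2
    have h3 := notMem_polygonVertices_of_mem_openEdge hn h3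
    fin_cases i
    exacts [iff_of_true h0 (by decide), iff_of_true h1 (by decide), iff_of_false h2 (by decide),
      iff_of_false h3 (by decide)]

end pair

section counting

variable {n : ℕ}

lemma eq_of_cis_two_mul_eq (hn : n ≠ 0) {k l : ℤ} (h : cis n (2 * k) = cis n (2 * l))
    (hlt : |k - l| < n) : k = l := by
  rw [cis_eq_iff hn, ← mul_sub, mul_dvd_mul_iff_left two_ne_zero] at h
  exact sub_eq_zero.mp (Int.eq_zero_of_abs_lt_dvd h hlt)

/-- The parallelogram spanned by the sides from the vertex `k` of the regular `n`-gon to the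
vertices `k + p` and `k + q`, as the tuple of its corners indexed by `(k, p, q)`. -/
def cornerTuple (n : ℕ) (i : ℤ × ℤ × ℤ) : Fin 4 → ℂ :=
  ![cis n (2 * (i.1 + i.2.1)), cis n (2 * i.1), cis n (2 * (i.1 + i.2.2)),
    oppositeCorner n i.1 i.2.1 i.2.2]

/-- The indices of `cornerTuple`: a base vertex `k` and the offsets `p` and `q` from it of two
vertices different from it. -/
def cornerIndices (n : ℕ) : Finset (ℤ × ℤ × ℤ) :=
  Finset.Ico 0 (n : ℤ) ×ˢ Finset.Ioo 0 (n : ℤ) ×ˢ Finset.Ioo 0 (n : ℤ)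

lemma mem_cornerIndices {k p q : ℤ} : (k, p, q) ∈ cornerIndices n ↔
    k ∈ Set.Ico 0 (n : ℤ) ∧ p ∈ Set.Ioo 0 (n : ℤ) ∧ q ∈ Set.Ioo 0 (n : ℤ) := by
  simp only [cornerIndices, Finset.mem_product, Finset.mem_Ico, Finset.mem_Ioo, Set.mem_Ico,
    Set.mem_Ioo]

lemma injOn_cornerTuple (hn : n ≠ 0) : Set.InjOn (cornerTuple n) (cornerIndices n) := by
  rintro ⟨k, p, q⟩ hi ⟨l, r, s⟩ hj h
  obtain ⟨hk, hp, hq⟩ := mem_cornerIndices.mp hi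
  obtain ⟨hl, hr, hs⟩ := mem_cornerIndices.mp hj
  simp only [Set.mem_Ico, Set.mem_Ioo] at hk hp hq hl hr hs
  obtain rfl : k = l := eq_of_cis_two_mul_eq hn (congrFun h 1) (by rw [abs_lt]; omega)
  have hpr := eq_of_cis_two_mul_eq hn (congrFun h 0) (by dsimp only; rw [abs_lt]; omega)
  have hqs := eq_of_cis_two_mul_eq hn (congrFun h 2) (by dsimp only; rw [abs_lt]; omega)
  exact Prod.ext rfl (Prod.ext (add_left_cancel hpr) (add_left_cancel hqs))

lemma exists_cornerTuple_eq (hn : n ≠ 0) {x : Fin 4 → ℂ} (hx : x ∈ vertexTuples n)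
    (hV : ∀ i ∈ ({0, 1, 2} : Finset (Fin 4)), x i ∈ polygonVertices n) :
    ∃ i ∈ cornerIndices n, cornerTuple n i = x := by
  obtain ⟨hne0, hne2⟩ := ne_of_mem_vertexTuples hx
  obtain ⟨k, hk, h1⟩ := exists_mem_Ico_eq_cis hn (hV 1 (by decide))
  obtain ⟨p, hp, h0⟩ := exists_sub_mem_Ioo_eq_cis hn k (hV 0 (by decide)) (h1 ▸ hne0)
  obtain ⟨q, hq, h2⟩ := exists_sub_mem_Ioo_eq_cis hn k (hV 2 (by decide)) (h1 ▸ hne2)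
  refine ⟨(k, p - k, q - k), mem_cornerIndices.mpr ⟨hk, hp, hq⟩, ?_⟩
  have h3 : oppositeCorner n k (p - k) (q - k) = x 3 := by
    rw [oppositeCorner, add_sub_cancel, add_sub_cancel, ← h0, ← h1, ← h2, hx.2.1,
      add_sub_cancel_left]
  funext i
  fin_cases i <;> simp [cornerTuple, h0, h1, h2, h3]

lemma cornerTuple_mem_vertexTuples_iff (hn : 3 ≤ n) {k p q : ℤ} (hp : p ∈ Set.Ioo 0 (n : ℤ))
    (hq : q ∈ Set.Ioo 0 (n : ℤ)) :
    cornerTuple n (k, p, q) ∈ vertexTuples n ↔ n ≤ 2 * |p - q| := by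
  rw [← oppositeCorner_mem_iff hn k hp hq]
  refine ⟨fun h => h.1 3, fun h => ?_⟩
  have hV (l : ℤ) : cis n (2 * l) ∈ polygonVertices n := cis_two_mul_mem_polygonVertices l
  refine ⟨fun i => ?_, ?_, isRigid_of_three_vertices (by omega) (hV _) (hV _) (hV _), ?_⟩
  · have hQ := polygonVertices_subset (n := n) (by omega)
    fin_cases i
    exacts [hQ (hV _), hQ (hV _), hQ (hV _), h]
  · exact (add_sub_cancel _ _).symm
  · have hle := (oppositeCorner_mem_iff hn k hp hq).mp h
    change planeDet (cis n (2 * (k + p)) - cis n (2 * k)) (cis n (2 * (k + q)) - cis n (2 * k)) ≠ 0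
    rw [planeDet_sub_cis_sub_cis]
    refine mul_ne_zero four_ne_zero (mul_ne_zero (mul_ne_zero ?_ ?_) ?_)
    · exact (cis_im_pos hp.1 hp.2).ne'
    · exact (cis_im_pos hq.1 hq.2).ne'
    · rw [Ne, cis_im_eq_zero_iff (by omega)]
      intro hdvd
      have hzero := Int.eq_zero_of_abs_lt_dvd hdvd
        (abs_sub_lt_of_nonneg_of_lt hq.1.le hq.2 hp.1.le hp.2)
      rw [abs_sub_comm, hzero, abs_zero] at hle
      omega

lemma encard_patternTuples_of_subset (hn : 3 ≤ n) {S : Finset (Fin 4)} (hS : {0, 1, 2} ⊆ S)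
    {R : ℤ → ℤ → Prop} [DecidableRel R] (hR : ∀ k p q, p ∈ Set.Ioo 0 (n : ℤ) →
      q ∈ Set.Ioo 0 (n : ℤ) → (cornerTuple n (k, p, q) ∈ patternTuples n S ↔ R p q)) :
    (patternTuples n S).encard =
      n * ({i ∈ Finset.Ioo 0 (n : ℤ) ×ˢ Finset.Ioo 0 (n : ℤ) | R i.1 i.2}.card : ℕ) := by
  have himage : patternTuples n S =
      cornerTuple n '' ({i ∈ cornerIndices n | R i.2.1 i.2.2} : Finset _) := by
    ext x
    simp only [Set.mem_image, SetLike.mem_coe, Finset.mem_filter]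
    constructor
    · intro hx
      obtain ⟨⟨k, p, q⟩, hi, rfl⟩ := exists_cornerTuple_eq (by omega) hx.1
        fun i hi => (hx.2 i).mpr (hS hi)
      obtain ⟨-, hp, hq⟩ := mem_cornerIndices.mp hi
      exact ⟨_, ⟨hi, (hR k p q hp hq).mp hx⟩, rfl⟩
    · rintro ⟨⟨k, p, q⟩, ⟨hi, hpq⟩, rfl⟩
      obtain ⟨-, hp, hq⟩ := mem_cornerIndices.mp hi
      exact (hR k p q hp hq).mpr hpq
  have hinj := (injOn_cornerTuple (n := n) (by omega)).mono
    (Finset.coe_subset.mpr (Finset.filter_subset (fun i => R i.2.1 i.2.2) _))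
  rw [himage, hinj.encard_image, Set.encard_coe_eq_coe_finsetCard, cornerIndices,
    Finset.filter_product_right (fun i : ℤ × ℤ => R i.1 i.2), Finset.card_product,
    Int.card_Ico, sub_zero, Int.toNat_natCast, Nat.cast_mul]

lemma card_filter_lt_two_mul_abs_sub (n : ℕ) :
    {i ∈ Finset.Ioo 0 (n : ℤ) ×ˢ Finset.Ioo 0 (n : ℤ) | (n : ℤ) < 2 * |i.1 - i.2|}.card =
      (n - 1) / 2 * ((n - 1) / 2 - 1) := by
  have hcard : (Finset.Ico 0 (((n - 1) / 2 : ℕ) : ℤ)).offDiag.card =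
      (n - 1) / 2 * ((n - 1) / 2 - 1) := by
    rw [Finset.offDiag_card, Int.card_Ico, sub_zero, Int.toNat_natCast, Nat.mul_sub_one]
  rw [← hcard]
  refine Finset.card_nbij'
    (fun i => if i.2 < i.1 then (i.1 - n / 2 - 1, i.2 - 1) else (i.1 - 1, i.2 - n / 2 - 1))
    (fun i => if i.2 < i.1 then (i.1 + n / 2 + 1, i.2 + 1) else (i.1 + 1, i.2 + n / 2 + 1))
    ?_ ?_ ?_ ?_ <;> rintro ⟨p, q⟩ hi <;>
    simp only [Finset.coe_filter, SetLike.mem_coe, Finset.mem_product, Finset.mem_Ioo,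
      Set.mem_ofPred_eq, Finset.mem_offDiag, Finset.mem_Ico] at hi ⊢ <;>
    grind

lemma card_filter_eq_two_mul_abs_sub {n : ℕ} (hn : 3 ≤ n) (heven : Even n) :
    {i ∈ Finset.Ioo 0 (n : ℤ) ×ˢ Finset.Ioo 0 (n : ℤ) | (n : ℤ) = 2 * |i.1 - i.2|}.card =
      n - 2 := by
  obtain ⟨h, rfl⟩ := heven
  have hcard : ((Finset.Ioo 0 ((h + h : ℕ) : ℤ)).erase h).card = h + h - 2 := by
    rw [Finset.card_erase_of_mem (by rw [Finset.mem_Ioo]; omega), Int.card_Ioo]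
    omega
  rw [← hcard]
  refine Finset.card_nbij' Prod.fst (fun p => (p, if p < h then p + h else p - h))
    ?_ ?_ ?_ ?_ <;> rintro i hi <;>
    simp only [Finset.coe_filter, SetLike.mem_coe, Finset.mem_product, Finset.mem_Ioo,
      Set.mem_ofPred_eq, Finset.mem_erase] at hi ⊢ <;>
    grind

end counting

section cardinality

variable {n : ℕ}

lemma cornerTuple_mem_polygonVertices_iff (hn : 3 ≤ n) {k p q : ℤ} (hp : p ∈ Set.Ioo 0 (n : ℤ))
    (hq : q ∈ Set.Ioo 0 (n : ℤ)) (i : Fin 4) :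
    cornerTuple n (k, p, q) i ∈ polygonVertices n ↔ i ∈ ({0, 1, 2} : Finset (Fin 4)) ∨
      n = 2 * |p - q| := by
  have hV (l : ℤ) : cis n (2 * l) ∈ polygonVertices n := cis_two_mul_mem_polygonVertices l
  have h3 := oppositeCorner_mem_polygonVertices_iff hn k hp hq
  fin_cases i
  exacts [iff_of_true (hV _) (.inl (by decide)), iff_of_true (hV _) (.inl (by decide)),
    iff_of_true (hV _) (.inl (by decide)), h3.trans (or_iff_right (by decide)).symm]

lemma cornerTuple_mem_patternTuples_univ_iff (hn : 3 ≤ n) (k p q : ℤ)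
    (hp : p ∈ Set.Ioo 0 (n : ℤ)) (hq : q ∈ Set.Ioo 0 (n : ℤ)) :
    cornerTuple n (k, p, q) ∈ patternTuples n Finset.univ ↔ n = 2 * |p - q| := by
  rw [patternTuples, Set.mem_ofPred_eq, cornerTuple_mem_vertexTuples_iff hn hp hq]
  simp only [cornerTuple_mem_polygonVertices_iff hn hp hq, Finset.mem_univ, iff_true]
  exact ⟨fun h => (h.2 3).resolve_left (by decide), fun h => ⟨h.le, fun _ => .inr h⟩⟩

lemma cornerTuple_mem_patternTuples_triple_iff (hn : 3 ≤ n) (k p q : ℤ)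
    (hp : p ∈ Set.Ioo 0 (n : ℤ)) (hq : q ∈ Set.Ioo 0 (n : ℤ)) :
    cornerTuple n (k, p, q) ∈ patternTuples n {0, 1, 2} ↔ n < 2 * |p - q| := by
  rw [patternTuples, Set.mem_ofPred_eq, cornerTuple_mem_vertexTuples_iff hn hp hq,
    lt_iff_le_and_ne]
  simp only [cornerTuple_mem_polygonVertices_iff hn hp hq, or_iff_left_iff_imp]
  exact and_congr_right fun _ =>
    ⟨fun h heq => absurd (h 3 heq) (by decide), fun h _ heq => (h heq).elim⟩

lemma encard_patternTuples_univ_of_even (hn : 3 ≤ n) (heven : Even n) :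
    (patternTuples n Finset.univ).encard = (n * (n - 2) : ℕ) := by
  rw [encard_patternTuples_of_subset hn (Finset.subset_univ _)
    (cornerTuple_mem_patternTuples_univ_iff hn), card_filter_eq_two_mul_abs_sub hn heven,
    Nat.cast_mul]

lemma patternTuples_univ_eq_empty (hn : 3 ≤ n) (hodd : Odd n) :
    patternTuples n Finset.univ = ∅ := by
  rw [← Set.encard_eq_zero, encard_patternTuples_of_subset hn (Finset.subset_univ _)
    (cornerTuple_mem_patternTuples_univ_iff hn), Finset.filter_false_of_mem, Finset.card_empty,
    Nat.cast_zero, mul_zero]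
  obtain ⟨m, rfl⟩ := hodd
  omega

lemma encard_patternTuples_triple (hn : 3 ≤ n) :
    (patternTuples n {0, 1, 2}).encard = (n * ((n - 1) / 2 * ((n - 1) / 2 - 1)) : ℕ) := by
  rw [encard_patternTuples_of_subset hn subset_rfl (cornerTuple_mem_patternTuples_triple_iff hn),
    card_filter_lt_two_mul_abs_sub, ← Nat.cast_mul]

lemma injOn_adjacentTuple (hn : n ≠ 0) :
    Set.InjOn (fun i : ℤ × ℤ => adjacentTuple n (i.1 + i.2) i.1)
      (Set.Ico 0 (n : ℤ) ×ˢ Set.Ioo 0 (n : ℤ)) := by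
  rintro ⟨k, r⟩ ⟨hk, hr⟩ ⟨l, s⟩ ⟨hl, hs⟩ h
  simp only [Set.mem_Ico, Set.mem_Ioo] at hk hr hl hs
  obtain rfl : k = l := eq_of_cis_two_mul_eq hn (congrFun h 1) (by rw [abs_lt]; omega)
  have hrs := eq_of_cis_two_mul_eq hn (congrFun h 0) (by dsimp only; rw [abs_lt]; omega)
  exact Prod.ext rfl (add_left_cancel hrs)

lemma chordRatio_pos_iff_of_mem_Ioo {m : ℤ} (hm : (n : ℤ) = 2 * m + 1) {r : ℤ}
    (hr : r ∈ Set.Ioo 0 (n : ℤ)) : 0 < chordRatio n r ↔ r ≠ m ∧ r ≠ m + 1 := by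
  obtain ⟨hr0, hrn⟩ := hr
  have hdvd {a : ℤ} (h0 : 0 < a) (h1 : a < 2 * n) : (n : ℤ) ∣ a ↔ a = n := by
    refine ⟨fun h => sub_eq_zero.mp (Int.eq_zero_of_abs_lt_dvd (dvd_sub_self_right.mpr h) ?_), ?_⟩
    · rw [abs_lt]
      omega
    · rintro rfl
      rfl
  rw [chordRatio_pos_iff hm, hdvd (by omega) (by omega), hdvd (by omega) (by omega)]
  omega

lemma patternTuples_pair_eq_image (hn : 3 ≤ n) {m : ℤ} (hm : (n : ℤ) = 2 * m + 1) :
    patternTuples n {0, 1} = (fun i : ℤ × ℤ => adjacentTuple n (i.1 + i.2) i.1) ''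
      (Set.Ico 0 (n : ℤ) ×ˢ {r ∈ Set.Ioo 0 (n : ℤ) | 0 < chordRatio n r}) := by
  ext x
  constructor
  · intro hx
    obtain ⟨p, q, hq, hpq, hpos, rfl⟩ := exists_adjacentTuple_eq hn hm hx
    exact ⟨(q, p - q), ⟨hq, hpq, hpos⟩, by dsimp only; rw [add_sub_cancel]⟩
  · rintro ⟨⟨k, r⟩, ⟨-, hr, hpos⟩, rfl⟩
    apply adjacentTuple_mem_patternTuples hn hm
    · rw [add_sub_cancel_left]
      exact not_dvd_of_mem_Ioo hr
    · rwa [add_sub_cancel_left]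

lemma encard_setOf_chordRatio_pos (hn : 3 ≤ n) {m : ℤ} (hm : (n : ℤ) = 2 * m + 1) :
    {r ∈ Set.Ioo 0 (n : ℤ) | 0 < chordRatio n r}.encard = (n - 3 : ℕ) := by
  have heq : {r ∈ Set.Ioo 0 (n : ℤ) | 0 < chordRatio n r} =
      (Finset.Ioo 0 (n : ℤ) \ {m, m + 1} : Finset ℤ) := by
    ext r
    rw [Set.mem_ofPred_eq, and_congr_right fun hr => chordRatio_pos_iff_of_mem_Ioo hm hr]
    simp only [Set.mem_Ioo, Finset.coe_sdiff, Finset.coe_Ioo, Finset.coe_insert,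
      Finset.coe_singleton, Set.mem_sdiff, Set.mem_insert_iff, Set.mem_singleton_iff, not_or]
  have hsub : {m, m + 1} ⊆ Finset.Ioo 0 (n : ℤ) := by
    simp only [Finset.insert_subset_iff, Finset.singleton_subset_iff, Finset.mem_Ioo]
    omega
  rw [heq, Set.encard_coe_eq_coe_finsetCard, Finset.card_sdiff_of_subset hsub, Int.card_Ioo,
    Finset.card_pair (by omega)]
  congr 1
  omega

lemma encard_patternTuples_pair_of_odd (hn : 3 ≤ n) (hodd : Odd n) :
    (patternTuples n {0, 1}).encard = (n * (n - 3) : ℕ) := by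
  obtain ⟨m, hm⟩ := hodd
  have hm : (n : ℤ) = 2 * (m : ℤ) + 1 := by omega
  have hinj := (injOn_adjacentTuple (n := n) (by omega)).mono
    (Set.prod_mono_right (Set.sep_subset _ fun r => 0 < chordRatio n r))
  rw [patternTuples_pair_eq_image hn hm, hinj.encard_image, Set.encard_prod,
    encard_setOf_chordRatio_pos hn hm, ← Finset.coe_Ico, Set.encard_coe_eq_coe_finsetCard,
    Int.card_Ico, sub_zero, Int.toNat_natCast, Nat.cast_mul]

lemma encard_vertexTuples_of_even (hn : 3 ≤ n) (heven : Even n) :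
    (vertexTuples n).encard = (n * (n - 2) * (n - 3) : ℕ) := by
  rw [encard_vertexTuples hn, encard_patternTuples_univ_of_even hn heven,
    encard_patternTuples_triple hn, patternTuples_pair_eq_empty hn heven, Set.encard_empty,
    mul_zero, add_zero]
  obtain ⟨l, rfl⟩ : ∃ l, n = 2 * (l + 2) := by
    obtain ⟨h, rfl⟩ := heven
    exact ⟨h - 2, by omega⟩
  rw [show (2 * (l + 2) - 1) / 2 = l + 1 by omega, Nat.add_sub_cancel,
    show 2 * (l + 2) - 2 = 2 * l + 2 by omega, show 2 * (l + 2) - 3 = 2 * l + 1 by omega]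
  norm_cast
  ring

lemma encard_vertexTuples_of_odd (hn : 3 ≤ n) (hodd : Odd n) :
    (vertexTuples n).encard = (n * (n - 3) * (n + 3) : ℕ) := by
  rw [encard_vertexTuples hn, patternTuples_univ_eq_empty hn hodd, encard_patternTuples_triple hn,
    encard_patternTuples_pair_of_odd hn hodd, Set.encard_empty, zero_add]
  obtain ⟨l, rfl⟩ : ∃ l, n = 2 * (l + 1) + 1 := by
    obtain ⟨m, rfl⟩ := hodd
    exact ⟨m - 1, by omega⟩
  rw [Nat.add_sub_cancel, Nat.mul_div_cancel_left _ two_pos, Nat.add_sub_cancel,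
    show 2 * (l + 1) + 1 - 3 = 2 * l by omega]
  norm_cast
  ring

end cardinality

end

theorem mainTheorem7 (n : ℕ) (hn : 3 ≤ n) :
    (verticesOfRank (regularPolygon 4) (regularPolygon n) 2).Finite ∧
    (Odd n →
      ((verticesOfRank (regularPolygon 4) (regularPolygon n) 2).ncard : ℤ)
        = (n : ℤ) ^ 3 - 9 * (n : ℤ)) ∧
    (Even n →
      ((verticesOfRank (regularPolygon 4) (regularPolygon n) 2).ncard : ℤ)
        = (n : ℤ) ^ 3 - 5 * (n : ℤ) ^ 2 + 6 * (n : ℤ)) := by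
  have hencard : (verticesOfRank (regularPolygon 4) (regularPolygon n) 2).encard =
      (vertexTuples n).encard := by
    rw [← image_squareTuple_verticesOfRank_two, squareTuple_injective.encard_image]
  have heven := fun h => hencard.trans (encard_vertexTuples_of_even hn h)
  have hodd := fun h => hencard.trans (encard_vertexTuples_of_odd hn h)
  obtain ⟨l, rfl⟩ := Nat.exists_eq_add_of_le' hn
  refine ⟨?_, fun h => ?_, fun h => ?_⟩
  · rcases (l + 3).even_or_odd with h | h
    exacts [Set.finite_of_encard_eq_coe (heven h), Set.finite_of_encard_eq_coe (hodd h)]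
  · rw [Set.ncard, hodd h, ENat.toNat_natCast, Nat.add_sub_cancel]
    push_cast
    ring
  · rw [Set.ncard, heven h, ENat.toNat_natCast, Nat.add_sub_cancel, show l + 3 - 2 = l + 1 by omega]
    push_cast
    ring
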